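/- Let $c,d$ be nonnegative integers and let $\mathrm U(c,d)=\{T\in\mathrm{Mat}(c+d,\mathbb C): T^*GT=G\}$, where $G=\mathrm{diag}(\mathbf 1_c,-\mathbf 1_d)$. For an invertible complex matrix $T$ let $\sigma_1(T)\ge\sigma_2(T)\ge\cdots$ be its singular values, and put $$N_d(T)=\sum_{i=1}^{d}\ln\frac{\sigma_i(T)+\sigma_i(T)^{-1}}{2}.$$ Let $(\mathbb X,\mathfrak A,\mu)$ be a probability space, $f:\mathbb X\to\mathbb X$ a measure-preserving map, and $A:\mathbb X\to \mathrm U(c,d)$ a measurable map such that $x\mapsto\ln\|A(x)\|$ is $\mu$-integrable. For $\theta\in[0,1]$ let $U_\theta=\mathrm{diag}(e^{2\pi i\theta}\mathbf 1_c,\mathbf 1_d)$. For $B:\mathbb X\to\mathrm U(c,d)$ write $B_n(x)=B(f^{n-1}(x))\cdots B(f(x))B(x)$, and define the Lyapunov exponents $$L_k(f,B)=\lim_{n\to\infty}\frac1n\int_{\mathbb X}\ln\sigma_k(B_n(x))\,d\mu(x),\qquad L^d(f,B)=\sum_{k=1}^d L_k(f,B).$$ Then for every $\theta\in[0,1]$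 the Lyapunov exponents $L_k(f,U_\theta A)$, $1\le k\le c+d$, exist as real numbers (the functions $\ln\sigma_k((U_\theta A)_n(\cdot))$ are $\mu$-integrable and the limits exist), the function $\theta\mapsto L^d(f,U_\theta A)$ is integrable on $[0,1]$, the function $x\mapsto N_d(A(x))$ is $\mu$-integrable, and $$\int_0^1 L^d(f,U_\theta A)\,d\theta=\int_{\mathbb X}N_d(A(x))\,d\mu(x).$$ -/

import Mathlib

open MeasureTheory Filter Topology

noncomputable section

/-- The matrix `diag(1_c, -1_d)` of the standard hermitian form of signature `(c, d)`. -/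
def signatureForm (c d : ℕ) : Matrix (Fin c ⊕ Fin d) (Fin c ⊕ Fin d) ℂ :=
  Matrix.fromBlocks 1 0 0 (-1)

/-- The pseudo-unitary group `U(c, d)`, as a set of complex `(c + d) × (c + d)` matrices. -/
def pseudoUnitary (c d : ℕ) : Set (Matrix (Fin c ⊕ Fin d) (Fin c ⊕ Fin d) ℂ) :=
  {T | T.conjTranspose * signatureForm c d * T = signatureForm c d}

/-- The unitary matrix `U_θ = diag(e^{2πiθ} 1_c, 1_d)`. -/
def phaseRotation (c d : ℕ) (θ : ℝ) : Matrix (Fin c ⊕ Fin d) (Fin c ⊕ Fin d) ℂ :=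
  Matrix.fromBlocks (Complex.exp (2 * (Real.pi : ℂ) * Complex.I * (θ : ℂ)) • 1) 0 0 1

/-- The singular values of a square complex matrix, in nonincreasing order with multiplicity.
Indices start at `0`, so that `singVal T k` is the `(k + 1)`-st singular value. -/
def singVal {ι : Type*} [Fintype ι] [DecidableEq ι] (T : Matrix ι ι ℂ) (k : ℕ) : ℝ :=
  (Matrix.toEuclideanLin T).singularValues k

/-- `N_r(T) = ∑_{i = 1}^r ln ((σ_i(T) + σ_i(T)⁻¹) / 2)`. -/
def hermanN {ι : Type*} [Fintype ι] [DecidableEq ι] (r : ℕ) (T : Matrix ι ι ℂ) : ℝ :=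
  ∑ i ∈ Finset.range r, Real.log ((singVal T i + (singVal T i)⁻¹) / 2)

/-- Log-integrable `U(c, d)`-valued cocycles: measurable maps `A : X → U(c, d)` such that
`x ↦ ln ‖A x‖` (operator norm for the euclidean norm) is integrable. -/
def logIntegrable {X : Type*} [MeasurableSpace X] (μ : Measure X) (c d : ℕ) :
    Set (X → Matrix (Fin c ⊕ Fin d) (Fin c ⊕ Fin d) ℂ) :=
  {A | (∀ i j, Measurable (fun x => A x i j)) ∧ (∀ x, A x ∈ pseudoUnitary c d) ∧
    Integrable (fun x => Real.log ‖Matrix.toEuclideanCLM (𝕜 := ℂ) (A x)‖) μ}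

/-- The iterates `A_n(x) = A(f^{n-1} x) ⋯ A(f x) A(x)` of the cocycle `(f, A)`. -/
def cocycleIter {X ι : Type*} [Fintype ι] [DecidableEq ι] (f : X → X)
    (A : X → Matrix ι ι ℂ) : ℕ → X → Matrix ι ι ℂ
  | 0, _ => 1
  | n + 1, x => A (f^[n] x) * cocycleIter f A n x

/-- The sequence `n ↦ (1/n) ∫ ln σ_{k+1}(A_n(x)) dμ(x)`, whose limit is the Lyapunov exponent
`L_{k+1}`. -/
def lyapunovSeq {X ι : Type*} [MeasurableSpace X] [Fintype ι] [DecidableEq ι] (μ : Measure X)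
    (f : X → X) (A : X → Matrix ι ι ℂ) (k : ℕ) (n : ℕ) : ℝ :=
  (1 / (n : ℝ)) * ∫ x, Real.log (singVal (cocycleIter f A n x) k) ∂μ

/-- The Lyapunov exponent `L_{k+1}(f, A)` (indices start at `0`); meaningful when
`LyapunovExists μ f A k` holds. -/
def lyapunovExponent {X ι : Type*} [MeasurableSpace X] [Fintype ι] [DecidableEq ι]
    (μ : Measure X) (f : X → X) (A : X → Matrix ι ι ℂ) (k : ℕ) : ℝ :=
  limUnder atTop (lyapunovSeq μ f A k)

/-- The Lyapunov exponent `L_{k+1}(f, A)` exists as a real number: the integrals in its definition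
converge, and so does the sequence of their averages. -/
def LyapunovExists {X ι : Type*} [MeasurableSpace X] [Fintype ι] [DecidableEq ι]
    (μ : Measure X) (f : X → X) (A : X → Matrix ι ι ℂ) (k : ℕ) : Prop :=
  (∀ n, Integrable (fun x => Real.log (singVal (cocycleIter f A n x) k)) μ) ∧
    Tendsto (lyapunovSeq μ f A k) atTop (𝓝 (lyapunovExponent μ f A k))

/-- `L^r(f, A) = L_1(f, A) + ⋯ + L_r(f, A)`, the sum of the top `r` Lyapunov exponents. -/
def lyapunovSum {X ι : Type*} [MeasurableSpace X] [Fintype ι] [DecidableEq ι]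
    (μ : Measure X) (f : X → X) (A : X → Matrix ι ι ℂ) (r : ℕ) : ℝ :=
  ∑ k ∈ Finset.range r, lyapunovExponent μ f A k

end

/-! For `T` in `U(c,d)` the product of `(σ_i + σ_i⁻¹)/2` over the top `d` singular values is `|det
D|`, where `D` is the lower right block of `T`; so `N_d(T) = ln |det D|`
(`hermanN_eq_log_norm_det`).

This makes Herman's subharmonicity argument exact. Replace `e^{2πiθ}` by `z` in the closed unit
disc. The `n`-th iterate is then entire in `z` and never increases the form of signature `(c,d)`,
which forces `det D ≠ 0`. Hence `ln |det D|` is harmonic there, and its mean over the circle is its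
value at `z = 0`, where the block of the iterate factors along the orbit. So the mean over `θ` of
`N_d` of the `n`-th iterate is the sum of `N_d(A(f^k x))` for `k < n`
(`integral_hermanN_cocycleIter`). Integrating in `x` gives `n ∫ N_d(A)`.

Finally `N_d` differs from `∑ ln σ_i` by at most `d ln 2`, which disappears after division by `n`,
and dominated convergence in `θ` gives the formula. The exponents exist by Fekete's lemma, applied
to partial sums of `ln σ_i` through Horn's inequality. Integrability rests on the symmetry of the
singular values under inversion, which yields `|ln σ_k| ≤ ln ‖T‖`. -/

/-! ### Variational theory of singular values -/

section SingularValues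

open Module

theorem inner_eq_zero_of_mem_span_image {E ι : Type*} [NormedAddCommGroup E]
    [InnerProductSpace ℂ E] [Fintype ι] (u : OrthonormalBasis ι ℂ E)
    {s : Set ι} {v : E} (hv : v ∈ Submodule.span ℂ (u '' s)) {i : ι} (hi : i ∉ s) :
    inner ℂ (u i) v = 0 := by
  induction hv using Submodule.span_induction with
  | mem x hx =>
    obtain ⟨j, hj, rfl⟩ := hx
    exact u.orthonormal.2 (fun h => hi (h ▸ hj))
  | zero => simp
  | add x y _ _ hx hy => simp [hx, hy]
  | smul a x _ hx => simp [hx]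

theorem finrank_span_image_orthonormalBasis {E ι : Type*} [NormedAddCommGroup E]
    [InnerProductSpace ℂ E] [Fintype ι] (u : OrthonormalBasis ι ℂ E)
    (s : Finset ι) : finrank ℂ (Submodule.span ℂ (u '' (s : Set ι))) = s.card := by
  classical
  have h := finrank_span_eq_card (R := ℂ) (b := fun i : s => u i)
    (u.orthonormal.linearIndependent.comp _ Subtype.val_injective)
  rw [Fintype.card_coe] at h
  have hr : Set.range (fun i : s => u i) = u '' (s : Set ι) := by
    ext x
    simp
  rwa [hr] at h

variable {E F H : Type*} [NormedAddCommGroup E] [InnerProductSpace ℂ E] [FiniteDimensional ℂ E]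
  [NormedAddCommGroup F] [InnerProductSpace ℂ F] [FiniteDimensional ℂ F]
  [NormedAddCommGroup H] [InnerProductSpace ℂ H] [FiniteDimensional ℂ H]

/-- Eigenvectors of `T* T` diagonalise the quadratic form `‖T v‖²`. The min-max bounds below are all
read off from this formula. -/
theorem exists_orthonormalBasis_norm_sq_apply (T : E →ₗ[ℂ] F) :
    ∃ u : OrthonormalBasis (Fin (finrank ℂ E)) ℂ E, ∀ v,
      ‖T v‖ ^ 2 = ∑ i : Fin (finrank ℂ E), T.singularValues i ^ 2 * ‖inner ℂ (u i) v‖ ^ 2 := by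
  have hT := T.isSymmetric_adjoint_comp_self
  refine ⟨hT.eigenvectorBasis rfl, fun v => ?_⟩
  have h1 : (‖T v‖ ^ 2 : ℂ) = inner ℂ v ((T.adjoint ∘ₗ T) v) := by
    rw [LinearMap.comp_apply, LinearMap.adjoint_inner_right, inner_self_eq_norm_sq_to_K]
    norm_cast
  have h2 : (‖T v‖ ^ 2 : ℂ) =
      ((∑ i : Fin (finrank ℂ E), T.singularValues i ^ 2 * ‖inner ℂ (hT.eigenvectorBasis rfl i) v‖ ^ 2 : ℝ) : ℂ) := by
    rw [h1, ← (hT.eigenvectorBasis rfl).sum_inner_mul_inner]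
    simp only [Complex.ofReal_sum, Complex.ofReal_mul, Complex.ofReal_pow]
    refine Finset.sum_congr rfl fun i _ => ?_
    have h3 := hT.eigenvectorBasis_apply_self_apply rfl v i
    rw [OrthonormalBasis.repr_apply_apply, OrthonormalBasis.repr_apply_apply] at h3
    rw [h3, ← inner_conj_symm v, mul_left_comm, ← T.sq_singularValues_fin rfl i,
      Complex.conj_mul']
    simp
  exact_mod_cast h2

/-- The first `k` right singular vectors span a space on which `T` expands by the `k`-th singular
value; these spaces are nested. -/
theorem exists_nested_expanding (T : E →ₗ[ℂ] F) :
    ∃ W : ℕ → Submodule ℂ E, Monotone W ∧ (∀ k ≤ finrank ℂ E, finrank ℂ (W k) = k) ∧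
      ∀ k, ∀ v ∈ W (k + 1), T.singularValues k * ‖v‖ ≤ ‖T v‖ := by
  obtain ⟨u, hu⟩ := exists_orthonormalBasis_norm_sq_apply T
  refine ⟨fun k => Submodule.span ℂ (u '' ((Finset.univ.filter fun i : Fin (finrank ℂ E) => (i : ℕ) < k :) : Set _)),
    ?_, ?_, ?_⟩
  · intro a b hab
    refine Submodule.span_mono (Set.image_mono ?_)
    intro i hi
    simp only [Finset.coe_filter, Finset.mem_univ, true_and, Set.mem_ofPred_eq] at hi ⊢
    omega
  · intro k hk
    rw [finrank_span_image_orthonormalBasis, Fin.card_filter_val_lt, min_eq_right hk]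
  · intro k v hv
    refine le_of_sq_le_sq ?_ (norm_nonneg _)
    rw [mul_pow, hu, ← u.sum_sq_norm_inner_right, Finset.mul_sum]
    refine Finset.sum_le_sum fun i _ => ?_
    by_cases hi : (i : ℕ) < k + 1
    · gcongr
      · exact T.singularValues_nonneg _
      · exact T.singularValues_antitone (Nat.lt_succ_iff.mp hi)
    · rw [inner_eq_zero_of_mem_span_image u hv (by simpa using hi)]
      simp

theorem exists_contracting (T : E →ₗ[ℂ] F) {k : ℕ} (hk : k ≤ finrank ℂ E) :
    ∃ W : Submodule ℂ E, finrank ℂ W + k = finrank ℂ E ∧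
      ∀ v ∈ W, ‖T v‖ ≤ T.singularValues k * ‖v‖ := by
  obtain ⟨u, hu⟩ := exists_orthonormalBasis_norm_sq_apply T
  refine ⟨Submodule.span ℂ (u '' ((Finset.univ.filter fun i : Fin (finrank ℂ E) => k ≤ (i : ℕ) :) : Set _)), ?_, ?_⟩
  · rw [finrank_span_image_orthonormalBasis]
    have h := Finset.card_filter_add_card_filter_not (s := (Finset.univ : Finset (Fin (finrank ℂ E))))
      (fun i => (i : ℕ) < k)
    simp only [not_lt, Finset.card_univ, Fintype.card_fin] at h
    have h2 : (Finset.univ.filter fun i : Fin (finrank ℂ E) => (i : ℕ) < k).card = k := by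
      rw [Fin.card_filter_val_lt, min_eq_right hk]
    omega
  · intro v hv
    refine le_of_sq_le_sq ?_ (mul_nonneg (T.singularValues_nonneg _) (norm_nonneg _))
    rw [mul_pow, hu, ← u.sum_sq_norm_inner_right, Finset.mul_sum]
    refine Finset.sum_le_sum fun i _ => ?_
    by_cases hi : k ≤ (i : ℕ)
    · gcongr
      · exact T.singularValues_nonneg _
      · exact T.singularValues_antitone hi
    · rw [inner_eq_zero_of_mem_span_image u hv (by simpa using hi)]
      simp

theorem exists_ne_zero_mem_inf {W V : Submodule ℂ E}
    (h : finrank ℂ E < finrank ℂ W + finrank ℂ V) : ∃ v ∈ W, v ∈ V ∧ v ≠ 0 := by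
  have h1 := Submodule.finrank_sup_add_finrank_inf_eq W V
  have h2 := (W ⊔ V).finrank_le
  have h3 : W ⊓ V ≠ ⊥ := by
    rw [← Submodule.one_le_finrank_iff]
    omega
  obtain ⟨v, hv, hv0⟩ := Submodule.exists_mem_ne_zero_of_ne_bot h3
  exact ⟨v, hv.1, hv.2, hv0⟩

/-- One half of Courant–Fischer: by dimension count `W` meets the span of the right singular vectors
of index at least `k`, where `T` expands by at most `σ_k`. -/
theorem le_singularValues (T : E →ₗ[ℂ] F) {k : ℕ} {r : ℝ} (W : Submodule ℂ E)
    (hW : k < finrank ℂ W) (h : ∀ v ∈ W, r * ‖v‖ ≤ ‖T v‖) : r ≤ T.singularValues k := by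
  have h1 := W.finrank_le
  obtain ⟨V, hV, hV'⟩ := exists_contracting T (k := k) (by omega)
  obtain ⟨v, hv, hv', hv0⟩ := exists_ne_zero_mem_inf (W := W) (V := V) (by omega)
  exact le_of_mul_le_mul_right ((h v hv).trans (hV' v hv')) (norm_pos_iff.mpr hv0)

theorem singularValues_le (T : E →ₗ[ℂ] F) {k : ℕ} {r : ℝ} (hr : 0 ≤ r) (W : Submodule ℂ E)
    (hW : finrank ℂ E ≤ finrank ℂ W + k) (h : ∀ v ∈ W, ‖T v‖ ≤ r * ‖v‖) :
    T.singularValues k ≤ r := by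
  by_cases hk : k < finrank ℂ E
  · obtain ⟨V, -, hV, hV'⟩ := exists_nested_expanding T
    have h1 := hV (k + 1) hk
    obtain ⟨v, hv, hv', hv0⟩ := exists_ne_zero_mem_inf (W := W) (V := V (k + 1)) (by omega)
    exact le_of_mul_le_mul_right ((hV' k v hv').trans (h v hv)) (norm_pos_iff.mpr hv0)
  · rw [T.singularValues_of_finrank_le (not_lt.mp hk)]
    exact hr

/-- Weyl's perturbation inequality for singular values. -/
theorem singularValues_le_add (S T : E →ₗ[ℂ] F) {ε : ℝ}
    (h : ∀ v, ‖S v - T v‖ ≤ ε * ‖v‖) (hε : 0 ≤ ε) (k : ℕ) :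
    S.singularValues k ≤ T.singularValues k + ε := by
  by_cases hk : k ≤ finrank ℂ E
  · obtain ⟨W, hW, hW'⟩ := exists_contracting T hk
    refine singularValues_le S (add_nonneg (T.singularValues_nonneg _) hε) W hW.ge fun v hv => ?_
    have h1 := norm_le_norm_add_norm_sub' (S v) (T v)
    linarith [h v, hW' v hv]
  · rw [S.singularValues_of_finrank_le (not_le.mp hk).le]
    exact add_nonneg (T.singularValues_nonneg _) hε

theorem singularValues_domRestrict_le (T : E →ₗ[ℂ] F) (W : Submodule ℂ E) (k : ℕ) :
    (T.domRestrict W).singularValues k ≤ T.singularValues k := by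
  by_cases hk : k < finrank ℂ W
  · obtain ⟨V, -, hV, hV'⟩ := exists_nested_expanding (T.domRestrict W)
    refine le_singularValues T ((V (k + 1)).map W.subtype) ?_ ?_
    · rw [Submodule.finrank_map_subtype_eq, hV _ hk]
      omega
    · rintro _ ⟨v, hv, rfl⟩
      exact hV' k v hv
  · rw [LinearMap.singularValues_of_finrank_le _ (not_lt.mp hk)]
    exact T.singularValues_nonneg _

/-- The top `k` right singular vectors span a space whose volume `T` expands by at least the product
of the top `k` singular values. Nestedness of the expanding spaces lets each factor be bounded
inside this one space. -/
theorem exists_finrank_eq_prod_singularValues_le (T : E →ₗ[ℂ] F) {k : ℕ} (hk : k ≤ finrank ℂ E) :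
    ∃ W : Submodule ℂ E, finrank ℂ W = k ∧
      ∏ i ∈ Finset.range k, T.singularValues i ≤ (T.domRestrict W).normDet := by
  obtain ⟨V, hmono, hV, hV'⟩ := exists_nested_expanding T
  refine ⟨V k, hV k hk, ?_⟩
  rw [LinearMap.normDet_eq_prod_singularValues, hV k hk]
  refine Finset.prod_le_prod (fun i _ => T.singularValues_nonneg _) fun i hi => ?_
  have hik : i + 1 ≤ k := Finset.mem_range.mp hi
  refine le_singularValues _ ((V (i + 1)).comap (V k).subtype) ?_ ?_
  · rw [← Submodule.finrank_map_subtype_eq, Submodule.map_comap_subtype,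
      inf_eq_right.mpr (hmono hik), hV _ (hik.trans hk)]
    omega
  · intro v hv
    exact hV' i v hv

theorem normDet_domRestrict_le (T : E →ₗ[ℂ] F) (W : Submodule ℂ E) :
    (T.domRestrict W).normDet ≤ ∏ i ∈ Finset.range (finrank ℂ W), T.singularValues i := by
  rw [LinearMap.normDet_eq_prod_singularValues]
  exact Finset.prod_le_prod (fun i _ => LinearMap.singularValues_nonneg _ _)
    fun i _ => singularValues_domRestrict_le T W i

/-- Horn's inequality: partial products of singular values are submultiplicative. -/
theorem prod_singularValues_comp_le (S : F →ₗ[ℂ] H) (T : E →ₗ[ℂ] F) {k : ℕ}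
    (hk : k ≤ finrank ℂ E) :
    ∏ i ∈ Finset.range k, (S ∘ₗ T).singularValues i ≤
      (∏ i ∈ Finset.range k, S.singularValues i) * ∏ i ∈ Finset.range k, T.singularValues i := by
  obtain ⟨W, hW, hle⟩ := exists_finrank_eq_prod_singularValues_le (S ∘ₗ T) hk
  have hS : 0 ≤ ∏ i ∈ Finset.range k, S.singularValues i :=
    Finset.prod_nonneg fun i _ => S.singularValues_nonneg _
  have hT : 0 ≤ ∏ i ∈ Finset.range k, T.singularValues i :=
    Finset.prod_nonneg fun i _ => T.singularValues_nonneg _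
  have hcomp : (S ∘ₗ T).domRestrict W = S ∘ₗ T.domRestrict W := rfl
  -- Volume expansion is multiplicative along `W → T W → S T W`, and each factor is at most a
  -- product of top singular values.
  rw [hcomp, LinearMap.normDet_comp] at hle
  refine hle.trans ?_
  by_cases h0 : (T.domRestrict W).normDet = 0
  · rw [h0, mul_zero]
    exact mul_nonneg hS hT
  · have hr : finrank ℂ (T.domRestrict W).range = k := by
      rw [← hW]
      by_contra hne
      exact h0 (LinearMap.normDet_eq_zero_iff_rank_range_ne.mpr hne)
    have h1 := normDet_domRestrict_le S (T.domRestrict W).range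
    have h2 := normDet_domRestrict_le T W
    rw [hr] at h1
    rw [hW] at h2
    exact mul_le_mul h1 h2 (LinearMap.normDet_nonneg _) hS

/-- Cauchy–Schwarz gives `‖T v‖² = ⟪T* T v, v⟫ ≤ ‖T* T v‖ ‖v‖`. So `T*` expands the image under `T`
of the top `k + 1` right singular vectors by at least `σ_k`. -/
theorem singularValues_le_adjoint (T : E →ₗ[ℂ] F) (k : ℕ) :
    T.singularValues k ≤ T.adjoint.singularValues k := by
  by_cases hk : k < finrank ℂ E
  · rcases (T.singularValues_nonneg k).eq_or_lt with h0 | h0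
    · rw [← h0]
      exact LinearMap.singularValues_nonneg _ _
    obtain ⟨V, -, hV, hV'⟩ := exists_nested_expanding T
    have hinj : (T.domRestrict (V (k + 1))).ker = ⊥ := by
      rw [LinearMap.ker_eq_bot']
      rintro ⟨v, hv⟩ h
      have h1 := hV' k v hv
      rw [show T v = 0 from h, norm_zero] at h1
      have h2 : ‖v‖ ≤ 0 := by
        by_contra hc
        exact absurd h1 (not_le.mpr (mul_pos h0 (not_le.mp hc)))
      exact Subtype.ext (norm_le_zero_iff.mp h2)
    refine le_singularValues _ (T.domRestrict (V (k + 1))).range ?_ ?_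
    · rw [LinearMap.finrank_range_of_inj (LinearMap.ker_eq_bot.mp hinj), hV _ hk]
      omega
    · rintro _ ⟨⟨v, hv⟩, rfl⟩
      change _ * ‖T v‖ ≤ ‖T.adjoint (T v)‖
      have h1 := hV' k v hv
      have h2 : ‖T v‖ ^ 2 ≤ ‖T.adjoint (T v)‖ * ‖v‖ := by
        have h3 := norm_inner_le_norm (𝕜 := ℂ) (T.adjoint (T v)) v
        rw [LinearMap.adjoint_inner_left, inner_self_eq_norm_sq_to_K] at h3
        simpa using h3
      by_cases hv0 : ‖v‖ = 0
      · rw [norm_eq_zero] at hv0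
        simp [hv0]
      · have hvpos := lt_of_le_of_ne (norm_nonneg v) (Ne.symm hv0)
        refine le_of_mul_le_mul_right ?_ hvpos
        nlinarith [norm_nonneg (T v)]
  · rw [T.singularValues_of_finrank_le (not_lt.mp hk)]
    exact LinearMap.singularValues_nonneg _ _

theorem singularValues_adjoint (T : E →ₗ[ℂ] F) (k : ℕ) :
    T.adjoint.singularValues k = T.singularValues k := by
  refine le_antisymm ?_ (singularValues_le_adjoint T k)
  have h := singularValues_le_adjoint T.adjoint k
  rwa [LinearMap.adjoint_adjoint] at h

/-- If the adjoint of `t` inverts `t` up to an isometry, then the singular values of `t` are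
symmetric under inversion. -/
theorem singularValues_mul_singularValues_rev (t : E →ₗ[ℂ] E) (g : E →ₗᵢ[ℂ] E)
    (h : ∀ v, t.adjoint (g (t v)) = g v) {i : ℕ} (hi : i < finrank ℂ E) :
    t.singularValues i * t.singularValues (finrank ℂ E - 1 - i) = 1 := by
  -- At `g (t v)` the adjoint stretches by the reciprocal of the stretch of `t` at `v`, so
  -- contracting and expanding spaces of `t` become expanding and contracting spaces of its adjoint.
  have hnorm : ∀ v, ‖t.adjoint (g (t v))‖ = ‖v‖ := fun v => by rw [h, g.norm_map]
  have hinj : Function.Injective t := by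
    intro v w hvw
    apply g.injective
    rw [← h v, ← h w, hvw]
  have hinj' : Function.Injective (g.toLinearMap ∘ₗ t) := g.injective.comp hinj
  have hpos := t.injective_iff_forall_lt_finrank_singularValues_pos.mp hinj i hi
  have hdim : ∀ W : Submodule ℂ E,
      finrank ℂ (W.map (g.toLinearMap ∘ₗ t)) = finrank ℂ W := fun W =>
    (Submodule.equivMapOfInjective _ hinj' W).finrank_eq.symm
  rw [mul_eq_one_iff_inv_eq₀ hpos.ne']
  apply le_antisymm
  · obtain ⟨W, hW, hW'⟩ := exists_contracting t hi.le
    rw [← singularValues_adjoint t (finrank ℂ E - 1 - i)]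
    refine le_singularValues _ (W.map (g.toLinearMap ∘ₗ t)) ?_ ?_
    · rw [hdim]
      omega
    · rintro _ ⟨v, hv, rfl⟩
      change _ * ‖g (t v)‖ ≤ ‖t.adjoint (g (t v))‖
      rw [hnorm, g.norm_map, inv_mul_le_iff₀ hpos]
      exact hW' v hv
  · obtain ⟨V, -, hV, hV'⟩ := exists_nested_expanding t
    rw [← singularValues_adjoint t (finrank ℂ E - 1 - i)]
    refine singularValues_le _ (inv_nonneg.mpr hpos.le) ((V (i + 1)).map (g.toLinearMap ∘ₗ t)) ?_ ?_
    · rw [hdim, hV _ hi]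
      omega
    · rintro _ ⟨v, hv, rfl⟩
      change ‖t.adjoint (g (t v))‖ ≤ _ * ‖g (t v)‖
      rw [hnorm, g.norm_map, le_inv_mul_iff₀ hpos]
      exact hV' i v hv

theorem det_id_add_adjoint_comp_self (T : E →ₗ[ℂ] F) :
    (LinearMap.id + T.adjoint ∘ₗ T).det =
      ((∏ i ∈ Finset.range (finrank ℂ E), (1 + T.singularValues i ^ 2) : ℝ) : ℂ) := by
  have hT := T.isSymmetric_adjoint_comp_self
  rw [← LinearMap.det_toMatrix (hT.eigenvectorBasis rfl).toBasis, map_add,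
    hT.toMatrix_eigenvectorBasis rfl, LinearMap.toMatrix_id, ← Matrix.diagonal_one,
    Matrix.diagonal_add, Matrix.det_diagonal, ← Fin.prod_univ_eq_prod_range
      (fun i => 1 + T.singularValues i ^ 2)]
  push_cast
  refine Finset.prod_congr rfl fun i _ => ?_
  rw [Function.comp_apply, ← T.sq_singularValues_fin rfl i]
  simp

end SingularValues

/-! ### Singular values and operator norm of matrices -/

section MatrixSingularValues

open Module

variable {ι : Type*} [Fintype ι] [DecidableEq ι]

/-- The operator norm of a square complex matrix for the euclidean norm. -/
noncomputable def euclideanOpNorm (T : Matrix ι ι ℂ) : ℝ :=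
  ‖Matrix.toEuclideanCLM (𝕜 := ℂ) T‖

theorem norm_toEuclideanLin_le (T : Matrix ι ι ℂ) (v : EuclideanSpace ℂ ι) :
    ‖Matrix.toEuclideanLin T v‖ ≤ euclideanOpNorm T * ‖v‖ :=
  (Matrix.toEuclideanCLM (𝕜 := ℂ) T).le_opNorm v

theorem euclideanOpNorm_nonneg (T : Matrix ι ι ℂ) : 0 ≤ euclideanOpNorm T :=
  norm_nonneg _

theorem euclideanOpNorm_le_of_forall {T : Matrix ι ι ℂ} {r : ℝ} (hr : 0 ≤ r)
    (h : ∀ v, ‖Matrix.toEuclideanLin T v‖ ≤ r * ‖v‖) : euclideanOpNorm T ≤ r :=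
  ContinuousLinearMap.opNorm_le_bound _ hr h

theorem euclideanOpNorm_mul_le (S T : Matrix ι ι ℂ) :
    euclideanOpNorm (S * T) ≤ euclideanOpNorm S * euclideanOpNorm T := by
  unfold euclideanOpNorm
  rw [map_mul]
  exact norm_mul_le _ _

theorem singVal_nonneg (T : Matrix ι ι ℂ) (k : ℕ) : 0 ≤ singVal T k :=
  LinearMap.singularValues_nonneg _ k

theorem singVal_le_euclideanOpNorm (T : Matrix ι ι ℂ) (k : ℕ) :
    singVal T k ≤ euclideanOpNorm T := by
  refine singularValues_le _ (norm_nonneg _) ⊤ ?_ fun v _ => norm_toEuclideanLin_le T v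
  rw [finrank_top]
  omega

theorem prod_singVal_mul_le (S T : Matrix ι ι ℂ) {k : ℕ} (hk : k ≤ Fintype.card ι) :
    ∏ i ∈ Finset.range k, singVal (S * T) i ≤
      (∏ i ∈ Finset.range k, singVal S i) * ∏ i ∈ Finset.range k, singVal T i := by
  unfold singVal
  rw [Matrix.toLpLin_mul_same]
  exact prod_singularValues_comp_le _ _ (by simpa using hk)

theorem singVal_le_add (S T : Matrix ι ι ℂ) (k : ℕ) :
    singVal S k ≤ singVal T k +
      ‖Matrix.toEuclideanCLM (𝕜 := ℂ) S - Matrix.toEuclideanCLM (𝕜 := ℂ) T‖ :=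
  singularValues_le_add _ _ (fun v =>
    (Matrix.toEuclideanCLM (𝕜 := ℂ) S - Matrix.toEuclideanCLM (𝕜 := ℂ) T).le_opNorm v)
    (norm_nonneg _) k

theorem continuous_toEuclideanCLM :
    Continuous fun T : Matrix ι ι ℂ => Matrix.toEuclideanCLM (𝕜 := ℂ) T :=
  (Matrix.toEuclideanCLM (𝕜 := ℂ) (n := ι)).toAlgEquiv.toLinearMap.continuous_of_finiteDimensional

theorem continuous_euclideanOpNorm : Continuous (euclideanOpNorm : Matrix ι ι ℂ → ℝ) :=
  continuous_toEuclideanCLM.norm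

theorem continuous_singVal (k : ℕ) : Continuous fun T : Matrix ι ι ℂ => singVal T k := by
  rw [continuous_iff_continuousAt]
  intro T
  have h : Tendsto (fun S : Matrix ι ι ℂ =>
      ‖Matrix.toEuclideanCLM (𝕜 := ℂ) S - Matrix.toEuclideanCLM (𝕜 := ℂ) T‖) (𝓝 T) (𝓝 0) := by
    have h1 : Continuous fun S : Matrix ι ι ℂ =>
      ‖Matrix.toEuclideanCLM (𝕜 := ℂ) S - Matrix.toEuclideanCLM (𝕜 := ℂ) T‖ :=
      (continuous_toEuclideanCLM.sub continuous_const).norm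
    simpa using h1.tendsto T
  rw [ContinuousAt, tendsto_iff_dist_tendsto_zero]
  refine squeeze_zero (fun _ => dist_nonneg) (fun S => ?_) h
  rw [Real.dist_eq, abs_sub_le_iff]
  constructor
  · linarith [singVal_le_add S T k]
  · have h2 := singVal_le_add T S k
    rw [norm_sub_rev] at h2
    linarith

end MatrixSingularValues

/-! ### Singular values of pseudo-unitary matrices -/

section PseudoUnitary

open Module Matrix

variable {c d : ℕ}

/-- The hermitian form of signature `(c, d)`. -/
noncomputable def pseudoForm (v : Fin c ⊕ Fin d → ℂ) : ℝ :=
  ∑ i, ‖v (Sum.inl i)‖ ^ 2 - ∑ j, ‖v (Sum.inr j)‖ ^ 2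

theorem ofReal_pseudoForm (v : Fin c ⊕ Fin d → ℂ) :
    (pseudoForm v : ℂ) = star v ⬝ᵥ (signatureForm c d *ᵥ v) := by
  simp [pseudoForm, signatureForm, Matrix.fromBlocks_mulVec, dotProduct, Fintype.sum_sum_type,
    Complex.conj_mul', Matrix.neg_mulVec, sub_eq_add_neg]

theorem pseudoForm_mulVec {T : Matrix (Fin c ⊕ Fin d) (Fin c ⊕ Fin d) ℂ}
    (hT : T ∈ pseudoUnitary c d) (v : Fin c ⊕ Fin d → ℂ) :
    pseudoForm (T *ᵥ v) = pseudoForm v := by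
  have h : Tᴴ * signatureForm c d * T = signatureForm c d := hT
  have h2 : (pseudoForm (T *ᵥ v) : ℂ) = pseudoForm v := by
    rw [ofReal_pseudoForm, ofReal_pseudoForm, Matrix.star_mulVec, ← Matrix.dotProduct_mulVec,
      Matrix.mulVec_mulVec, Matrix.mulVec_mulVec, h]
  exact_mod_cast h2

theorem signatureForm_mul_self : signatureForm c d * signatureForm c d = 1 := by
  simp [signatureForm, Matrix.fromBlocks_multiply]

theorem pseudoUnitary_mul {S T : Matrix (Fin c ⊕ Fin d) (Fin c ⊕ Fin d) ℂ}
    (hS : S ∈ pseudoUnitary c d) (hT : T ∈ pseudoUnitary c d) : S * T ∈ pseudoUnitary c d := by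
  have hS' : Sᴴ * signatureForm c d * S = signatureForm c d := hS
  have hT' : Tᴴ * signatureForm c d * T = signatureForm c d := hT
  change (S * T)ᴴ * signatureForm c d * (S * T) = signatureForm c d
  rw [Matrix.conjTranspose_mul]
  calc Tᴴ * Sᴴ * signatureForm c d * (S * T) = Tᴴ * (Sᴴ * signatureForm c d * S) * T := by
        simp only [Matrix.mul_assoc]
    _ = _ := by rw [hS', hT']

theorem one_mem_pseudoUnitary : 1 ∈ pseudoUnitary c d := by
  simp [pseudoUnitary]

theorem norm_exp_two_pi_I_mul (θ : ℝ) :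
    ‖Complex.exp (2 * (Real.pi : ℂ) * Complex.I * (θ : ℂ))‖ = 1 := by
  rw [show (2 * (Real.pi : ℂ) * Complex.I * (θ : ℂ)) = ((2 * Real.pi * θ : ℝ) : ℂ) * Complex.I by
    push_cast; ring]
  exact Complex.norm_exp_ofReal_mul_I _

theorem phaseRotation_mem_pseudoUnitary (θ : ℝ) : phaseRotation c d θ ∈ pseudoUnitary c d := by
  have h : star (Complex.exp (2 * (Real.pi : ℂ) * Complex.I * (θ : ℂ))) *
      Complex.exp (2 * (Real.pi : ℂ) * Complex.I * (θ : ℂ)) = 1 := by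
    rw [Complex.star_def, Complex.conj_mul', norm_exp_two_pi_I_mul]
    simp
  change _ * _ * _ = _
  rw [phaseRotation, signatureForm, Matrix.fromBlocks_conjTranspose, Matrix.fromBlocks_multiply,
    Matrix.fromBlocks_multiply]
  rw [mul_comm] at h
  simp only [Matrix.conjTranspose_smul, Matrix.conjTranspose_one, Matrix.conjTranspose_zero,
    Matrix.mul_one, Matrix.one_mul, Matrix.mul_zero, Matrix.zero_mul, add_zero, zero_add,
    Matrix.mul_smul, smul_smul, smul_zero, h, one_smul]

theorem norm_toEuclideanLin_signatureForm (v : EuclideanSpace ℂ (Fin c ⊕ Fin d)) :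
    ‖Matrix.toEuclideanLin (signatureForm c d) v‖ = ‖v‖ := by
  rw [← sq_eq_sq₀ (norm_nonneg _) (norm_nonneg _), EuclideanSpace.norm_sq_eq,
    EuclideanSpace.norm_sq_eq]
  simp [signatureForm, Matrix.fromBlocks_mulVec, Fintype.sum_sum_type, Matrix.neg_mulVec]

theorem euclideanOpNorm_phaseRotation_le (θ : ℝ) : euclideanOpNorm (phaseRotation c d θ) ≤ 1 := by
  refine euclideanOpNorm_le_of_forall zero_le_one fun v => le_of_eq ?_
  rw [one_mul, ← sq_eq_sq₀ (norm_nonneg _) (norm_nonneg _), EuclideanSpace.norm_sq_eq,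
    EuclideanSpace.norm_sq_eq]
  simp [phaseRotation, Matrix.fromBlocks_mulVec, Fintype.sum_sum_type, Matrix.smul_mulVec,
    norm_exp_two_pi_I_mul]

variable {T : Matrix (Fin c ⊕ Fin d) (Fin c ⊕ Fin d) ℂ}

theorem singVal_mul_singVal_rev (hT : T ∈ pseudoUnitary c d) {i : ℕ} (hi : i < c + d) :
    singVal T i * singVal T (c + d - 1 - i) = 1 := by
  have h : Tᴴ * signatureForm c d * T = signatureForm c d := hT
  have hdim : finrank ℂ (EuclideanSpace ℂ (Fin c ⊕ Fin d)) = c + d := by simp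
  have := singularValues_mul_singularValues_rev (Matrix.toEuclideanLin T)
    ⟨Matrix.toEuclideanLin (signatureForm c d), norm_toEuclideanLin_signatureForm⟩
    (fun v => by
      change (Matrix.toEuclideanLin T).adjoint (Matrix.toEuclideanLin (signatureForm c d)
        (Matrix.toEuclideanLin T v)) = Matrix.toEuclideanLin (signatureForm c d) v
      rw [← Matrix.toEuclideanLin_conjTranspose_eq_adjoint]
      simp only [Matrix.toLpLin_apply, Matrix.mulVec_mulVec]
      rw [← Matrix.mul_assoc, h]) (i := i) (by rwa [hdim])
  rwa [hdim] at this

theorem singVal_pos (hT : T ∈ pseudoUnitary c d) {i : ℕ} (hi : i < c + d) : 0 < singVal T i := by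
  refine (singVal_nonneg T i).lt_of_ne fun h0 => ?_
  have h := singVal_mul_singVal_rev hT hi
  rw [← h0, zero_mul] at h
  exact zero_ne_one h

theorem singVal_rev (hT : T ∈ pseudoUnitary c d) {i : ℕ} (hi : i < c + d) :
    singVal T (c + d - 1 - i) = (singVal T i)⁻¹ :=
  eq_inv_of_mul_eq_one_right (singVal_mul_singVal_rev hT hi)

/-- `T` contracts the preimage of the kernel of one of the two coordinate projections. -/
theorem singVal_le_one_of_card_le (T : Matrix (Fin c ⊕ Fin d) (Fin c ⊕ Fin d) ℂ) {m : ℕ}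
    (e : Fin m → Fin c ⊕ Fin d)
    (h : ∀ v, (∀ j, (T *ᵥ v) (e j) = 0) → ∑ i, ‖(T *ᵥ v) i‖ ^ 2 ≤ ∑ i, ‖v i‖ ^ 2)
    {k : ℕ} (hk : m ≤ k) : singVal T k ≤ 1 := by
  let φ : EuclideanSpace ℂ (Fin c ⊕ Fin d) →ₗ[ℂ] (Fin m → ℂ) :=
    LinearMap.pi fun j => (LinearMap.proj (e j)).comp
      ((WithLp.linearEquiv 2 ℂ (Fin c ⊕ Fin d → ℂ)).toLinearMap ∘ₗ Matrix.toEuclideanLin T)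
  refine singularValues_le _ zero_le_one φ.ker ?_ ?_
  · have h1 := φ.finrank_range_add_finrank_ker
    have h2 := φ.range.finrank_le
    rw [finrank_fin_fun] at h2
    omega
  · intro v hv
    rw [one_mul]
    refine le_of_sq_le_sq ?_ (norm_nonneg _)
    rw [EuclideanSpace.norm_sq_eq, EuclideanSpace.norm_sq_eq]
    exact h v.ofLp fun j => congrFun (LinearMap.mem_ker.mp hv) j

/-- If the `d` negative coordinates of `T v` vanish, invariance of the form gives `‖T v‖² = Q(T v) =
Q(v) ≤ ‖v‖²`. -/
theorem singVal_le_one_of_le_right (hT : T ∈ pseudoUnitary c d) {k : ℕ} (hk : d ≤ k) :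
    singVal T k ≤ 1 := by
  refine singVal_le_one_of_card_le T Sum.inr (fun v hv => ?_) hk
  have h := pseudoForm_mulVec hT v
  simp only [pseudoForm, hv, norm_zero, Fintype.sum_sum_type] at h ⊢
  have h1 : 0 ≤ ∑ j, ‖v (Sum.inr j)‖ ^ 2 := Finset.sum_nonneg fun _ _ => by positivity
  simp at h ⊢
  linarith

theorem singVal_le_one_of_le_left (hT : T ∈ pseudoUnitary c d) {k : ℕ} (hk : c ≤ k) :
    singVal T k ≤ 1 := by
  refine singVal_le_one_of_card_le T Sum.inl (fun v hv => ?_) hk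
  have h := pseudoForm_mulVec hT v
  simp only [pseudoForm, hv, norm_zero, Fintype.sum_sum_type] at h ⊢
  have h1 : 0 ≤ ∑ j, ‖v (Sum.inl j)‖ ^ 2 := Finset.sum_nonneg fun _ _ => by positivity
  simp at h ⊢
  linarith

theorem one_le_singVal (hT : T ∈ pseudoUnitary c d) {k : ℕ} (hk : k < d) : 1 ≤ singVal T k := by
  have h := singVal_rev hT (i := k) (by omega)
  have h1 := singVal_le_one_of_le_left hT (k := c + d - 1 - k) (by omega)
  rw [h] at h1
  exact (inv_le_one₀ (singVal_pos hT (by omega))).mp h1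

theorem one_le_euclideanOpNorm (hT : T ∈ pseudoUnitary c d) (h : 0 < c + d) :
    1 ≤ euclideanOpNorm T := by
  have h1 := singVal_mul_singVal_rev hT h
  have h2 := singVal_le_euclideanOpNorm T 0
  have h3 := singVal_le_euclideanOpNorm T (c + d - 1 - 0)
  nlinarith [singVal_nonneg T 0, singVal_nonneg T (c + d - 1 - 0), euclideanOpNorm_nonneg T]

/-- In dimension zero the norm is not at least 1; the logarithmic bounds survive because `Real.log 0
= 0`. -/
theorem euclideanOpNorm_eq_zero (h : c + d = 0) : euclideanOpNorm T = 0 := by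
  have : IsEmpty (Fin c ⊕ Fin d) := by
    rw [← Fintype.card_eq_zero_iff]
    simpa using h
  rw [Subsingleton.elim T 0, euclideanOpNorm, map_zero, norm_zero]

theorem log_euclideanOpNorm_nonneg (hT : T ∈ pseudoUnitary c d) :
    0 ≤ Real.log (euclideanOpNorm T) := by
  rcases Nat.eq_zero_or_pos (c + d) with h | h
  · rw [euclideanOpNorm_eq_zero h, Real.log_zero]
  · exact Real.log_nonneg (one_le_euclideanOpNorm hT h)

theorem log_euclideanOpNorm_mul_le {S : Matrix (Fin c ⊕ Fin d) (Fin c ⊕ Fin d) ℂ}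
    (hS : S ∈ pseudoUnitary c d) (hT : T ∈ pseudoUnitary c d) :
    Real.log (euclideanOpNorm (S * T)) ≤
      Real.log (euclideanOpNorm S) + Real.log (euclideanOpNorm T) := by
  rcases Nat.eq_zero_or_pos (c + d) with h | h
  · simp [euclideanOpNorm_eq_zero h]
  · have h1 := one_le_euclideanOpNorm hS h
    have h2 := one_le_euclideanOpNorm hT h
    have h3 := one_le_euclideanOpNorm (pseudoUnitary_mul hS hT) h
    rw [← Real.log_mul (by positivity) (by positivity)]
    exact Real.log_le_log (by positivity) (euclideanOpNorm_mul_le S T)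

theorem log_euclideanOpNorm_phaseRotation_mul_le (hT : T ∈ pseudoUnitary c d) (θ : ℝ) :
    Real.log (euclideanOpNorm (phaseRotation c d θ * T)) ≤ Real.log (euclideanOpNorm T) := by
  have h := log_euclideanOpNorm_mul_le (phaseRotation_mem_pseudoUnitary (c := c) (d := d) θ) hT
  have h2 := Real.log_nonpos (euclideanOpNorm_nonneg _)
    (euclideanOpNorm_phaseRotation_le (c := c) (d := d) θ)
  linarith

/-- The lower bound is an upper bound in disguise, since `σ_k⁻¹` is again a singular value of `T`.
-/
theorem abs_log_singVal_le (hT : T ∈ pseudoUnitary c d) {k : ℕ} (hk : k < c + d) :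
    |Real.log (singVal T k)| ≤ Real.log (euclideanOpNorm T) := by
  have h1 := Real.log_le_log (singVal_pos hT hk) (singVal_le_euclideanOpNorm T k)
  have hk' : c + d - 1 - k < c + d := by omega
  have h2 := Real.log_le_log (singVal_pos hT hk') (singVal_le_euclideanOpNorm T _)
  rw [singVal_rev hT hk, Real.log_inv] at h2
  exact abs_le.mpr ⟨by linarith, h1⟩

/-! ### Herman's function as a block determinant -/

theorem signatureForm_mul_conjTranspose_mul (hT : T ∈ pseudoUnitary c d) :
    T * (signatureForm c d * Tᴴ * signatureForm c d) = 1 := by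
  have h : Tᴴ * signatureForm c d * T = signatureForm c d := hT
  rw [mul_eq_one_comm]
  calc signatureForm c d * Tᴴ * signatureForm c d * T
      = signatureForm c d * (Tᴴ * signatureForm c d * T) := by simp only [Matrix.mul_assoc]
    _ = 1 := by rw [h, signatureForm_mul_self]

theorem norm_det_eq_one (hT : T ∈ pseudoUnitary c d) : ‖T.det‖ = 1 := by
  have h : Tᴴ * signatureForm c d * T = signatureForm c d := hT
  have h1 := congrArg Matrix.det h
  have h2 := congrArg Matrix.det (signatureForm_mul_self (c := c) (d := d))
  rw [Matrix.det_mul, Matrix.det_one] at h2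
  rw [Matrix.det_mul, Matrix.det_mul, Matrix.det_conjTranspose] at h1
  have h3 : star T.det * T.det = 1 := by
    linear_combination (signatureForm c d).det * h1 + (1 - star T.det * T.det) * h2
  rw [Complex.star_def, Complex.conj_mul'] at h3
  have h4 : ‖T.det‖ ^ 2 = 1 := by exact_mod_cast h3
  exact (pow_eq_one_iff_of_nonneg (norm_nonneg _) two_ne_zero).mp h4

theorem norm_det_toBlocks₁₁ (hT : T ∈ pseudoUnitary c d) :
    ‖T.toBlocks₁₁.det‖ = ‖T.toBlocks₂₂.det‖ := by
  have h := signatureForm_mul_conjTranspose_mul hT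
  rw [← Matrix.fromBlocks_toBlocks T, signatureForm, Matrix.fromBlocks_conjTranspose,
    Matrix.fromBlocks_multiply, Matrix.fromBlocks_multiply, Matrix.fromBlocks_multiply,
    ← Matrix.fromBlocks_one, Matrix.fromBlocks_inj] at h
  simp only [Matrix.one_mul, Matrix.zero_mul, add_zero, Matrix.mul_one, Matrix.mul_zero, zero_add,
    Matrix.neg_mul] at h
  -- The right factor is `T⁻¹ = G T* G` with its second block column replaced by that of the
  -- identity; determinants then compare the two diagonal blocks.
  have key : T * Matrix.fromBlocks T.toBlocks₁₁ᴴ 0 (-T.toBlocks₁₂ᴴ) 1 =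
      Matrix.fromBlocks 1 T.toBlocks₁₂ 0 T.toBlocks₂₂ := by
    nth_rewrite 1 [← Matrix.fromBlocks_toBlocks T]
    rw [Matrix.fromBlocks_multiply, Matrix.fromBlocks_inj]
    simp only [Matrix.mul_one, Matrix.mul_zero, zero_add]
    exact ⟨h.1, trivial, h.2.2.1, trivial⟩
  have hdet := congrArg (fun M => ‖Matrix.det M‖) key
  simpa [Matrix.det_mul, Matrix.det_fromBlocks_zero₁₂, Matrix.det_fromBlocks_zero₂₁,
    norm_det_eq_one hT, Matrix.det_conjTranspose] using hdet

theorem prod_one_add_singVal_sq (T : Matrix (Fin c ⊕ Fin d) (Fin c ⊕ Fin d) ℂ) :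
    (1 + Tᴴ * T).det = ((∏ i ∈ Finset.range (c + d), (1 + singVal T i ^ 2) : ℝ) : ℂ) := by
  have hdim : finrank ℂ (EuclideanSpace ℂ (Fin c ⊕ Fin d)) = c + d := by simp
  have h := det_id_add_adjoint_comp_self (Matrix.toEuclideanLin T)
  rw [hdim, ← Matrix.toEuclideanLin_conjTranspose_eq_adjoint, ← Matrix.toLpLin_mul_same,
    ← Matrix.toLpLin_one, ← map_add, LinearMap.det_toLpLin] at h
  exact h

theorem prod_singVal (hT : T ∈ pseudoUnitary c d) :
    ∏ i ∈ Finset.range (c + d), singVal T i = 1 := by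
  have hdim : finrank ℂ (EuclideanSpace ℂ (Fin c ⊕ Fin d)) = c + d := by simp
  have h := LinearMap.normDet_eq_prod_singularValues (Matrix.toEuclideanLin T)
  rw [LinearMap.normDet_eq_norm_det, LinearMap.det_toLpLin, norm_det_eq_one hT, hdim] at h
  exact h.symm

/-- From `1 = G G = T* G T G` follows `1 + T* T = T* (G T G + T)`, and `G T G + T` is twice the
block diagonal part of `T`. Take determinants, using that both diagonal blocks have the same
`|det|`. -/
theorem prod_singVal_add_inv_div_two (hT : T ∈ pseudoUnitary c d) :
    ∏ i ∈ Finset.range (c + d), ((singVal T i + (singVal T i)⁻¹) / 2) =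
      ‖T.toBlocks₂₂.det‖ ^ 2 := by
  have h : Tᴴ * signatureForm c d * T = signatureForm c d := hT
  have hG : signatureForm c d * T * signatureForm c d + T =
      (2 : ℂ) • Matrix.fromBlocks T.toBlocks₁₁ 0 0 T.toBlocks₂₂ := by
    conv_lhs => rw [← Matrix.fromBlocks_toBlocks T]
    rw [signatureForm, Matrix.fromBlocks_multiply, Matrix.fromBlocks_multiply,
      Matrix.fromBlocks_add, Matrix.fromBlocks_smul]
    simp [two_smul]
  have h1 : 1 + Tᴴ * T = Tᴴ * ((2 : ℂ) • Matrix.fromBlocks T.toBlocks₁₁ 0 0 T.toBlocks₂₂) := by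
    rw [← hG, mul_add, ← signatureForm_mul_self]
    congr 1
    nth_rewrite 1 [← h]
    simp only [Matrix.mul_assoc]
  have h2 := congrArg (fun M => ‖Matrix.det M‖) h1
  simp only [Matrix.det_mul, Matrix.det_smul, Matrix.det_fromBlocks_zero₁₂, norm_mul,
    Matrix.det_conjTranspose, norm_star, norm_det_eq_one hT, norm_det_toBlocks₁₁ hT,
    prod_one_add_singVal_sq, Complex.norm_real] at h2
  rw [Real.norm_of_nonneg (Finset.prod_nonneg fun i _ => by positivity)] at h2
  have h3 : ∀ i ∈ Finset.range (c + d), (singVal T i + (singVal T i)⁻¹) / 2 =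
      (1 + singVal T i ^ 2) * (2 * singVal T i)⁻¹ := by
    intro i hi
    have := singVal_pos hT (Finset.mem_range.mp hi)
    field_simp
    ring
  rw [Finset.prod_congr rfl h3, Finset.prod_mul_distrib, h2, Finset.prod_inv_distrib,
    Finset.prod_mul_distrib, prod_singVal hT]
  simp
  field_simp

theorem prod_range_right_eq_left (hT : T ∈ pseudoUnitary c d) :
    ∏ i ∈ Finset.range c, ((singVal T i + (singVal T i)⁻¹) / 2) =
      ∏ i ∈ Finset.range d, ((singVal T i + (singVal T i)⁻¹) / 2) := by
  -- For a middle index both `σ_i` and its mirror image `σ_i⁻¹` are at most 1, so the factor is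
  -- trivial.
  have key : ∀ i, i < c + d → min c d ≤ i → min c d ≤ c + d - 1 - i →
      (singVal T i + (singVal T i)⁻¹) / 2 = 1 := by
    intro i hi h1 h2
    have hle : ∀ j, min c d ≤ j → singVal T j ≤ 1 := by
      intro j hj
      rcases le_total c d with hcd | hcd
      · exact singVal_le_one_of_le_left hT (by omega)
      · exact singVal_le_one_of_le_right hT (by omega)
    have h3 := hle i h1
    have h4 := hle _ h2
    rw [singVal_rev hT hi, inv_le_one₀ (singVal_pos hT hi)] at h4
    rw [le_antisymm h3 h4]
    norm_num
  rcases le_total c d with hcd | hcd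
  · refine Finset.prod_subset (Finset.range_mono hcd) fun i hi hi' => ?_
    rw [Finset.mem_range] at hi hi'
    exact key i (by omega) (by omega) (by omega)
  · refine (Finset.prod_subset (Finset.range_mono hcd) fun i hi hi' => ?_).symm
    rw [Finset.mem_range] at hi hi'
    exact key i (by omega) (by omega) (by omega)

theorem prod_singVal_add_inv_div_two_eq_norm_det (hT : T ∈ pseudoUnitary c d) :
    ∏ i ∈ Finset.range d, ((singVal T i + (singVal T i)⁻¹) / 2) = ‖T.toBlocks₂₂.det‖ := by
  have hnn : ∀ i, 0 ≤ (singVal T i + (singVal T i)⁻¹) / 2 := fun i => by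
    have := singVal_nonneg T i
    positivity
  rw [← sq_eq_sq₀ (Finset.prod_nonneg fun i _ => hnn i) (norm_nonneg _),
    ← prod_singVal_add_inv_div_two hT, add_comm c d, Finset.prod_range_add, sq]
  congr 1
  -- The last `c` factors mirror the first `c`, whose product equals that of the first `d`; the full
  -- product is thus a square.
  rw [← prod_range_right_eq_left hT, ← Finset.prod_range_reflect]
  refine Finset.prod_congr rfl fun j hj => ?_
  rw [Finset.mem_range] at hj
  have h := singVal_rev hT (i := c - 1 - j) (by omega)
  rw [show c + d - 1 - (c - 1 - j) = d + j by omega] at h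
  rw [h, inv_inv, add_comm]

theorem hermanN_eq_log_norm_det (hT : T ∈ pseudoUnitary c d) :
    hermanN d T = Real.log ‖T.toBlocks₂₂.det‖ := by
  rw [← prod_singVal_add_inv_div_two_eq_norm_det hT, Real.log_prod, hermanN]
  intro i hi
  have := singVal_pos hT (i := i) (by have := Finset.mem_range.mp hi; omega)
  positivity

theorem log_half_add_inv_bounds {s : ℝ} (hs : 1 ≤ s) :
    0 ≤ Real.log ((s + s⁻¹) / 2) ∧ Real.log ((s + s⁻¹) / 2) ≤ Real.log s ∧
      Real.log s ≤ Real.log ((s + s⁻¹) / 2) + Real.log 2 := by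
  have h0 : 0 < s := by linarith
  have h1 : s⁻¹ ≤ 1 := inv_le_one_of_one_le₀ hs
  have h2 : 0 < s⁻¹ := by positivity
  have h3 : s * s⁻¹ = 1 := mul_inv_cancel₀ h0.ne'
  refine ⟨Real.log_nonneg ?_, Real.log_le_log (by positivity) (by linarith), ?_⟩
  · nlinarith [sq_nonneg (s - 1)]
  · rw [← Real.log_mul (by positivity) (by norm_num)]
    exact Real.log_le_log h0 (by linarith)

/-- For `s ≥ 1` the mean `(s + s⁻¹)/2` lies between `s/2` and `s`. The bound does not depend on `T`,
so the error vanishes in the average over `n` iterates. -/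
theorem abs_sum_log_singVal_sub_hermanN_le (hT : T ∈ pseudoUnitary c d) :
    |∑ i ∈ Finset.range d, Real.log (singVal T i) - hermanN d T| ≤ d * Real.log 2 := by
  rw [hermanN, ← Finset.sum_sub_distrib]
  refine (Finset.abs_sum_le_sum_abs _ _).trans ?_
  refine (Finset.sum_le_card_nsmul _ _ (Real.log 2) fun i hi => ?_).trans (by simp)
  obtain ⟨-, h1, h2⟩ := log_half_add_inv_bounds (one_le_singVal hT (Finset.mem_range.mp hi))
  rw [abs_of_nonneg (by linarith)]
  linarith

theorem abs_hermanN_le (hT : T ∈ pseudoUnitary c d) :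
    |hermanN d T| ≤ d * Real.log (euclideanOpNorm T) := by
  rw [hermanN]
  refine (Finset.abs_sum_le_sum_abs _ _).trans ?_
  refine (Finset.sum_le_card_nsmul _ _ (Real.log (euclideanOpNorm T)) fun i hi => ?_).trans
    (by simp)
  have hi' := Finset.mem_range.mp hi
  obtain ⟨h0, h1, -⟩ := log_half_add_inv_bounds (one_le_singVal hT hi')
  rw [abs_of_nonneg h0]
  exact h1.trans ((le_abs_self _).trans (abs_log_singVal_le hT (by omega)))

end PseudoUnitary

/-! ### Extension to the disc and the mean value property -/

section MeanValue

open Matrix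

variable {c d : ℕ}

/-- The matrix `diag(z 1_c, 1_d)`, which extends `phaseRotation` to the unit disc. -/
noncomputable def discRotation (c d : ℕ) (z : ℂ) : Matrix (Fin c ⊕ Fin d) (Fin c ⊕ Fin d) ℂ :=
  Matrix.fromBlocks (z • 1) 0 0 1

theorem pseudoForm_discRotation_mulVec_le {z : ℂ} (hz : ‖z‖ ≤ 1) (v : Fin c ⊕ Fin d → ℂ) :
    pseudoForm (discRotation c d z *ᵥ v) ≤ pseudoForm v := by
  simp only [pseudoForm, discRotation, Matrix.fromBlocks_mulVec, Matrix.smul_mulVec,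
    Matrix.one_mulVec, Matrix.zero_mulVec, add_zero, zero_add, Sum.elim_inl, Sum.elim_inr,
    Pi.smul_apply, Function.comp_apply, smul_eq_mul, norm_mul]
  gcongr with i
  exact mul_le_of_le_one_left (norm_nonneg _) hz

/-- A kernel vector `w ≠ 0` of the block would send `(0, w)`, where the form is negative, to a
vector `(u, 0)`, where it is nonnegative. -/
theorem det_toBlocks₂₂_ne_zero {T : Matrix (Fin c ⊕ Fin d) (Fin c ⊕ Fin d) ℂ}
    (hT : ∀ v, pseudoForm (T *ᵥ v) ≤ pseudoForm v) : T.toBlocks₂₂.det ≠ 0 := by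
  intro h
  obtain ⟨w, hw, hw0⟩ := Matrix.exists_mulVec_eq_zero_iff.mpr h
  have h1 := hT (Sum.elim 0 w)
  have h2 : T *ᵥ (Sum.elim 0 w) = Sum.elim (T.toBlocks₁₂ *ᵥ w) 0 := by
    nth_rewrite 1 [← Matrix.fromBlocks_toBlocks T]
    rw [Matrix.fromBlocks_mulVec, Sum.elim_comp_inl, Sum.elim_comp_inr, hw0, Matrix.mulVec_zero,
      Matrix.mulVec_zero, zero_add, zero_add]
  rw [h2] at h1
  simp only [pseudoForm, Sum.elim_inl, Sum.elim_inr, Pi.zero_apply, norm_zero] at h1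
  have h3 : 0 ≤ ∑ i, ‖(T.toBlocks₁₂ *ᵥ w) i‖ ^ 2 := Finset.sum_nonneg fun _ _ => by positivity
  have h4 : ∑ j, ‖w j‖ ^ 2 ≤ 0 := by simp at h1; linarith
  apply hw
  ext j
  have h5 := (Finset.sum_eq_zero_iff_of_nonneg (fun j _ => sq_nonneg ‖w j‖)).mp
    (le_antisymm h4 (Finset.sum_nonneg fun _ _ => sq_nonneg _)) j (Finset.mem_univ j)
  simpa using h5

variable {X : Type*} (f : X → X) {A : X → Matrix (Fin c ⊕ Fin d) (Fin c ⊕ Fin d) ℂ}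

theorem pseudoForm_cocycleIter_mulVec_le {B : X → Matrix (Fin c ⊕ Fin d) (Fin c ⊕ Fin d) ℂ}
    (hB : ∀ x v, pseudoForm (B x *ᵥ v) ≤ pseudoForm v) (n : ℕ) (x : X) (v : Fin c ⊕ Fin d → ℂ) :
    pseudoForm (cocycleIter f B n x *ᵥ v) ≤ pseudoForm v := by
  induction n with
  | zero => simp [cocycleIter]
  | succ n ih =>
    rw [cocycleIter, ← Matrix.mulVec_mulVec]
    exact (hB _ _).trans ih

theorem differentiable_cocycleIter_discRotation_apply
    (A : X → Matrix (Fin c ⊕ Fin d) (Fin c ⊕ Fin d) ℂ) (n : ℕ) (x : X) (i j : Fin c ⊕ Fin d) :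
    Differentiable ℂ fun z => cocycleIter f (fun x => discRotation c d z * A x) n x i j := by
  have hR : ∀ i j, Differentiable ℂ fun z => discRotation c d z i j := by
    rintro (i | i) (j | j) <;> simp [discRotation, Matrix.fromBlocks, Matrix.smul_apply]
  induction n generalizing i j with
  | zero => exact differentiable_const _
  | succ n ih =>
    simp only [cocycleIter, Matrix.mul_apply]
    fun_prop

theorem differentiable_det_toBlocks₂₂_cocycleIter
    (A : X → Matrix (Fin c ⊕ Fin d) (Fin c ⊕ Fin d) ℂ) (n : ℕ) (x : X) :
    Differentiable ℂ fun z =>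
      (cocycleIter f (fun x => discRotation c d z * A x) n x).toBlocks₂₂.det := by
  have h := differentiable_cocycleIter_discRotation_apply f A n x
  simp only [Matrix.det_apply, Matrix.toBlocks₂₂, Matrix.of_apply]
  fun_prop

/-- At `z = 0` each step kills the upper block row. The vanishing upper right block is the invariant
that makes the lower right block multiplicative. -/
theorem toBlocks_cocycleIter_discRotation_zero
    (A : X → Matrix (Fin c ⊕ Fin d) (Fin c ⊕ Fin d) ℂ) (n : ℕ) (x : X) :
    (cocycleIter f (fun x => discRotation c d 0 * A x) n x).toBlocks₁₂ = 0 ∧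
      (cocycleIter f (fun x => discRotation c d 0 * A x) n x).toBlocks₂₂.det =
        ∏ k ∈ Finset.range n, (A (f^[k] x)).toBlocks₂₂.det := by
  induction n with
  | zero =>
    simp only [cocycleIter, Finset.range_zero, Finset.prod_empty]
    rw [← Matrix.fromBlocks_one, Matrix.toBlocks_fromBlocks₁₂, Matrix.toBlocks_fromBlocks₂₂]
    simp
  | succ n ih =>
    obtain ⟨ih1, ih2⟩ := ih
    rw [cocycleIter]
    generalize cocycleIter f (fun x => discRotation c d 0 * A x) n x = S at ih1 ih2
    have h : discRotation c d 0 * A (f^[n] x) * S = Matrix.fromBlocks 0 0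
        ((A (f^[n] x)).toBlocks₂₁ * S.toBlocks₁₁ + (A (f^[n] x)).toBlocks₂₂ * S.toBlocks₂₁)
        ((A (f^[n] x)).toBlocks₂₂ * S.toBlocks₂₂) := by
      nth_rewrite 1 [← Matrix.fromBlocks_toBlocks S, ← Matrix.fromBlocks_toBlocks (A (f^[n] x))]
      rw [discRotation, Matrix.fromBlocks_multiply, Matrix.fromBlocks_multiply, ih1]
      simp
    rw [h, Matrix.toBlocks_fromBlocks₁₂, Matrix.toBlocks_fromBlocks₂₂, Matrix.det_mul, ih2,
      Finset.prod_range_succ, mul_comm]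
    exact ⟨rfl, rfl⟩

theorem integral_log_norm_eq_of_ne_zero {g : ℂ → ℂ} (hg : Differentiable ℂ g)
    (h0 : ∀ z, ‖z‖ ≤ 1 → g z ≠ 0) :
    ∫ θ in (0 : ℝ)..1,
      Real.log ‖g (Complex.exp (2 * (Real.pi : ℂ) * Complex.I * (θ : ℂ)))‖ = Real.log ‖g 0‖ := by
  have h1 : InnerProductSpace.HarmonicOnNhd (fun z => Real.log ‖g z‖)
      (Metric.closedBall (0 : ℂ) |1|) := fun z hz =>
    (hg.analyticAt z).harmonicAt_log_norm (h0 z (by simpa using hz))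
  have h2 := h1.circleAverage_eq
  rw [Real.circleAverage_def] at h2
  have h3 := intervalIntegral.integral_comp_mul_left (a := 0) (b := 1)
    (fun θ : ℝ => Real.log ‖g (circleMap 0 1 θ)‖) (c := 2 * Real.pi) (by positivity)
  rw [mul_zero, mul_one, h2] at h3
  rw [← h3]
  refine intervalIntegral.integral_congr fun θ _ => ?_
  simp only [circleMap, zero_add, Complex.ofReal_one, one_mul]
  congr 4
  push_cast
  ring

theorem cocycleIter_mem_pseudoUnitary {B : X → Matrix (Fin c ⊕ Fin d) (Fin c ⊕ Fin d) ℂ}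
    (hB : ∀ x, B x ∈ pseudoUnitary c d) (n : ℕ) (x : X) :
    cocycleIter f B n x ∈ pseudoUnitary c d := by
  induction n with
  | zero => exact one_mem_pseudoUnitary
  | succ n ih => exact pseudoUnitary_mul (hB _) ih

theorem integral_hermanN_cocycleIter (hA : ∀ x, A x ∈ pseudoUnitary c d) (n : ℕ) (x : X) :
    ∫ θ in (0 : ℝ)..1, hermanN d (cocycleIter f (fun x => phaseRotation c d θ * A x) n x) =
      ∑ k ∈ Finset.range n, hermanN d (A (f^[k] x)) := by
  have h0 : ∀ z : ℂ, ‖z‖ ≤ 1 →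
      (cocycleIter f (fun x => discRotation c d z * A x) n x).toBlocks₂₂.det ≠ 0 := fun z hz =>
    det_toBlocks₂₂_ne_zero <| pseudoForm_cocycleIter_mulVec_le f (fun x v => by
      rw [← Matrix.mulVec_mulVec]
      exact (pseudoForm_discRotation_mulVec_le hz _).trans (pseudoForm_mulVec (hA x) v).le) n x
  have h1 := integral_log_norm_eq_of_ne_zero
    (differentiable_det_toBlocks₂₂_cocycleIter f A n x) h0
  rw [(toBlocks_cocycleIter_discRotation_zero f A n x).2, norm_prod, Real.log_prod] at h1
  · rw [Finset.sum_congr rfl fun k _ => hermanN_eq_log_norm_det (hA (f^[k] x)), ← h1]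
    refine intervalIntegral.integral_congr fun θ _ => ?_
    exact hermanN_eq_log_norm_det (cocycleIter_mem_pseudoUnitary f
      (fun x => pseudoUnitary_mul (phaseRotation_mem_pseudoUnitary θ) (hA x)) n x)
  · intro k _
    rw [norm_ne_zero_iff]
    exact det_toBlocks₂₂_ne_zero fun v => (pseudoForm_mulVec (hA _) v).le

end MeanValue

/-! ### Measurability -/

section Measurability

theorem measurable_comp_matrix {Y ι : Type*} [MeasurableSpace Y] [Fintype ι]
    {F : Matrix ι ι ℂ → ℝ} (hF : Continuous F)
    {M : Y → Matrix ι ι ℂ} (hM : ∀ i j, Measurable fun y => M y i j) :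
    Measurable fun y => F (M y) := by
  have h1 : Measurable fun y => (fun i j => M y i j : ι → ι → ℂ) :=
    measurable_pi_iff.mpr fun i => measurable_pi_iff.mpr fun j => hM i j
  have h2 : Continuous fun m : ι → ι → ℂ => F (Matrix.of m) := hF
  exact h2.measurable.comp h1

variable {Y ι : Type*} [MeasurableSpace Y] [Fintype ι] [DecidableEq ι]

theorem measurable_hermanN (r : ℕ) {M : Y → Matrix ι ι ℂ}
    (hM : ∀ i j, Measurable fun y => M y i j) : Measurable fun y => hermanN r (M y) := by
  have h := fun k => measurable_comp_matrix (continuous_singVal (ι := ι) k) hM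
  unfold hermanN
  fun_prop

/-- The parameter space `Z` gives measurability jointly in `θ` and `x`, as Fubini requires. -/
theorem measurable_cocycleIter {X : Type*} [MeasurableSpace X] {f : X → X} (hf : Measurable f)
    {Z : Type*} [MeasurableSpace Z] {B : Z → X → Matrix ι ι ℂ}
    (hB : ∀ i j, Measurable fun p : Z × X => B p.1 p.2 i j) (n : ℕ) (i j : ι) :
    Measurable fun p : Z × X => cocycleIter f (B p.1) n p.2 i j := by
  induction n generalizing i j with
  | zero => exact measurable_const
  | succ n ih =>
    have h : ∀ k, Measurable fun p : Z × X => B p.1 (f^[n] p.2) i k := fun k =>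
      (hB i k).comp (measurable_fst.prodMk ((hf.iterate n).comp measurable_snd))
    simp only [cocycleIter, Matrix.mul_apply]
    fun_prop

end Measurability

/-! ### Existence of Lyapunov exponents -/

section Lyapunov

theorem cocycleIter_add {X ι : Type*} [Fintype ι] [DecidableEq ι] (f : X → X)
    (B : X → Matrix ι ι ℂ) (m n : ℕ) (x : X) :
    cocycleIter f B (m + n) x = cocycleIter f B m (f^[n] x) * cocycleIter f B n x := by
  induction m with
  | zero => simp [cocycleIter]
  | succ m ih =>
    rw [Nat.succ_add, cocycleIter, cocycleIter, ih, Function.iterate_add_apply, Matrix.mul_assoc]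

theorem log_euclideanOpNorm_cocycleIter_le {X : Type*} {f : X → X} {c d : ℕ}
    {B : X → Matrix (Fin c ⊕ Fin d) (Fin c ⊕ Fin d) ℂ} (hB : ∀ x, B x ∈ pseudoUnitary c d)
    (n : ℕ) (x : X) :
    Real.log (euclideanOpNorm (cocycleIter f B n x)) ≤
      ∑ j ∈ Finset.range n, Real.log (euclideanOpNorm (B (f^[j] x))) := by
  induction n with
  | zero =>
    rw [cocycleIter, Finset.range_zero, Finset.sum_empty]
    refine Real.log_nonpos (euclideanOpNorm_nonneg _)
      (euclideanOpNorm_le_of_forall zero_le_one fun v => ?_)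
    simp
  | succ n ih =>
    rw [Finset.sum_range_succ, cocycleIter]
    have := log_euclideanOpNorm_mul_le (hB (f^[n] x)) (cocycleIter_mem_pseudoUnitary f hB n x)
    linarith

theorem abs_log_singVal_cocycleIter_le {X : Type*} {f : X → X} {c d : ℕ}
    {B : X → Matrix (Fin c ⊕ Fin d) (Fin c ⊕ Fin d) ℂ} (hB : ∀ x, B x ∈ pseudoUnitary c d)
    (n : ℕ) (x : X) {k : ℕ}
    (hk : k < c + d) :
    |Real.log (singVal (cocycleIter f B n x) k)| ≤
      ∑ j ∈ Finset.range n, Real.log (euclideanOpNorm (B (f^[j] x))) :=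
  (abs_log_singVal_le (cocycleIter_mem_pseudoUnitary f hB n x) hk).trans
    (log_euclideanOpNorm_cocycleIter_le hB n x)

variable {X : Type*} [MeasurableSpace X] {μ : Measure X} {f : X → X} {c d : ℕ}
  {B : X → Matrix (Fin c ⊕ Fin d) (Fin c ⊕ Fin d) ℂ}

theorem integrable_comp_iterate (hf : MeasurePreserving f μ μ) {g : X → ℝ} (hg : Integrable g μ)
    (n : ℕ) : Integrable (fun x => g (f^[n] x)) μ :=
  ((hf.iterate n).integrable_comp hg.aestronglyMeasurable).mpr hg

theorem integral_comp_iterate (hf : MeasurePreserving f μ μ) {g : X → ℝ} (hg : Integrable g μ)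
    (n : ℕ) : ∫ x, g (f^[n] x) ∂μ = ∫ x, g x ∂μ := by
  have h := (hf.iterate n).map_eq
  rw [← integral_map (hf.iterate n).aemeasurable (by rw [h]; exact hg.aestronglyMeasurable), h]

theorem integrable_sum_comp_iterate (hf : MeasurePreserving f μ μ) {g : X → ℝ}
    (hg : Integrable g μ) (n : ℕ) :
    Integrable (fun x => ∑ j ∈ Finset.range n, g (f^[j] x)) μ :=
  integrable_finsetSum _ fun j _ => integrable_comp_iterate hf hg j

theorem integral_sum_comp_iterate (hf : MeasurePreserving f μ μ) {g : X → ℝ}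
    (hg : Integrable g μ) (n : ℕ) :
    ∫ x, ∑ j ∈ Finset.range n, g (f^[j] x) ∂μ = n * ∫ x, g x ∂μ := by
  rw [integral_finsetSum _ fun j _ => integrable_comp_iterate hf hg j]
  simp [integral_comp_iterate hf hg]

theorem integrable_log_euclideanOpNorm (hB : B ∈ logIntegrable μ c d) :
    Integrable (fun x => Real.log (euclideanOpNorm (B x))) μ :=
  hB.2.2

theorem measurable_cocycleIter_apply (hf : Measurable f)
    (hB : ∀ i j, Measurable fun x => B x i j) (n : ℕ) (i j : Fin c ⊕ Fin d) :
    Measurable fun x => cocycleIter f B n x i j :=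
  (measurable_cocycleIter hf (Z := Unit) (B := fun _ => B)
    (fun i j => (hB i j).comp measurable_snd) n i j).comp (measurable_prodMk_left (x := ()))

theorem integrable_log_singVal_cocycleIter (hf : MeasurePreserving f μ μ)
    (hB : B ∈ logIntegrable μ c d) (n : ℕ) {k : ℕ} (hk : k < c + d) :
    Integrable (fun x => Real.log (singVal (cocycleIter f B n x) k)) μ := by
  refine (integrable_sum_comp_iterate hf (integrable_log_euclideanOpNorm hB) n).mono' ?_ ?_
  · exact (Real.measurable_log.comp (measurable_comp_matrix (continuous_singVal k)
      (measurable_cocycleIter_apply hf.measurable hB.1 n))).aestronglyMeasurable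
  · exact Eventually.of_forall fun x => abs_log_singVal_cocycleIter_le hB.2.1 n x hk

theorem abs_integral_log_singVal_cocycleIter_le (hf : MeasurePreserving f μ μ)
    (hB : B ∈ logIntegrable μ c d) (n : ℕ) {k : ℕ} (hk : k < c + d) :
    |∫ x, Real.log (singVal (cocycleIter f B n x) k) ∂μ| ≤
      n * ∫ x, Real.log (euclideanOpNorm (B x)) ∂μ := by
  rw [← integral_sum_comp_iterate hf (integrable_log_euclideanOpNorm hB) n]
  rw [← Real.norm_eq_abs]
  exact norm_integral_le_of_norm_le
    (integrable_sum_comp_iterate hf (integrable_log_euclideanOpNorm hB) n)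
    (Eventually.of_forall fun x => abs_log_singVal_cocycleIter_le hB.2.1 n x hk)

theorem abs_lyapunovSeq_le (hf : MeasurePreserving f μ μ) (hB : B ∈ logIntegrable μ c d) (n : ℕ)
    {k : ℕ} (hk : k < c + d) :
    |lyapunovSeq μ f B k n| ≤ ∫ x, Real.log (euclideanOpNorm (B x)) ∂μ := by
  have h0 : 0 ≤ ∫ x, Real.log (euclideanOpNorm (B x)) ∂μ :=
    integral_nonneg fun x => log_euclideanOpNorm_nonneg (hB.2.1 x)
  rcases n.eq_zero_or_pos with rfl | hn
  · simpa [lyapunovSeq] using h0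
  · have hn' : (0 : ℝ) < n := Nat.cast_pos.mpr hn
    have h := abs_integral_log_singVal_cocycleIter_le hf hB n hk
    rw [lyapunovSeq, abs_mul, abs_of_pos (by positivity), one_div, inv_mul_le_iff₀ hn']
    exact h

theorem subadditive_sum_integral_log_singVal (hf : MeasurePreserving f μ μ)
    (hB : B ∈ logIntegrable μ c d) {k : ℕ} (hk : k ≤ c + d) :
    Subadditive fun n =>
      ∑ i ∈ Finset.range k, ∫ x, Real.log (singVal (cocycleIter f B n x) i) ∂μ := by
  intro m n
  have hi : ∀ i ∈ Finset.range k, i < c + d := fun i h => (Finset.mem_range.mp h).trans_le hk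
  have hint := fun n i h => integrable_log_singVal_cocycleIter hf hB n (hi i h)
  -- Invariance of `μ` moves the base point to `f^n x`, as in `B_{m+n}(x) = B_m(f^n x) B_n(x)`;
  -- Horn's inequality then applies pointwise.
  have hm : ∑ i ∈ Finset.range k, ∫ x, Real.log (singVal (cocycleIter f B m x) i) ∂μ =
      ∑ i ∈ Finset.range k, ∫ x, Real.log (singVal (cocycleIter f B m (f^[n] x)) i) ∂μ :=
    Finset.sum_congr rfl fun i h => (integral_comp_iterate hf (hint m i h) n).symm
  dsimp only
  rw [hm, ← Finset.sum_add_distrib]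
  have h2 : ∀ i ∈ Finset.range k,
      Integrable (fun x => Real.log (singVal (cocycleIter f B m (f^[n] x)) i)) μ :=
    fun i h => integrable_comp_iterate hf (hint m i h) n
  have h3 : ∀ i ∈ Finset.range k, Integrable (fun x =>
      Real.log (singVal (cocycleIter f B m (f^[n] x)) i) +
        Real.log (singVal (cocycleIter f B n x) i)) μ := fun i h => (h2 i h).add (hint n i h)
  rw [← integral_finsetSum _ (hint (m + n)),
    Finset.sum_congr rfl fun i h => (integral_add (h2 i h) (hint n i h)).symm,
    ← integral_finsetSum _ h3]
  refine integral_mono (integrable_finsetSum _ (hint (m + n))) (integrable_finsetSum _ h3)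
    fun x => ?_
  have hpos : ∀ n x, ∀ i ∈ Finset.range k, singVal (cocycleIter f B n x) i ≠ 0 := fun n x i h =>
    (singVal_pos (cocycleIter_mem_pseudoUnitary f hB.2.1 n x) (hi i h)).ne'
  have hpos' : ∀ n x, ∏ i ∈ Finset.range k, singVal (cocycleIter f B n x) i ≠ 0 := fun n x =>
    Finset.prod_ne_zero_iff.mpr (hpos n x)
  dsimp only
  rw [Finset.sum_add_distrib, ← Real.log_prod (hpos _ _), ← Real.log_prod (hpos _ _),
    ← Real.log_prod (hpos _ _), ← Real.log_mul (hpos' _ _) (hpos' _ _), cocycleIter_add]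
  refine Real.log_le_log ?_ (prod_singVal_mul_le _ _ (by simpa using hk))
  rw [← cocycleIter_add]
  exact Finset.prod_pos fun i h =>
    singVal_pos (cocycleIter_mem_pseudoUnitary f hB.2.1 _ x) (hi i h)

theorem exists_tendsto_sum_lyapunovSeq (hf : MeasurePreserving f μ μ)
    (hB : B ∈ logIntegrable μ c d) {k : ℕ} (hk : k ≤ c + d) :
    ∃ L, Tendsto (fun n => ∑ i ∈ Finset.range k, lyapunovSeq μ f B i n) atTop (𝓝 L) := by
  have h := subadditive_sum_integral_log_singVal hf hB hk
  have heq : ∀ n : ℕ, (∑ i ∈ Finset.range k,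
      ∫ x, Real.log (singVal (cocycleIter f B n x) i) ∂μ) / n =
        ∑ i ∈ Finset.range k, lyapunovSeq μ f B i n := fun n => by
    rw [Finset.sum_div]
    exact Finset.sum_congr rfl fun i _ => by rw [lyapunovSeq, one_div, div_eq_inv_mul]
  have hb : BddBelow (Set.range fun n : ℕ => (∑ i ∈ Finset.range k,
      ∫ x, Real.log (singVal (cocycleIter f B n x) i) ∂μ) / n) := by
    refine ⟨-(k * ∫ x, Real.log (euclideanOpNorm (B x)) ∂μ), ?_⟩
    rintro _ ⟨n, rfl⟩
    dsimp only
    rw [heq, neg_le]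
    refine (neg_le_abs _).trans ((Finset.abs_sum_le_sum_abs _ _).trans ?_)
    refine (Finset.sum_le_card_nsmul _ _ (∫ x, Real.log (euclideanOpNorm (B x)) ∂μ)
      fun i hi => abs_lyapunovSeq_le hf hB n ((Finset.mem_range.mp hi).trans_le hk)).trans ?_
    simp
  exact ⟨h.lim, (h.tendsto_lim hb).congr heq⟩

/-- Subadditivity is available only for partial sums over the top singular values, so a single
exponent is obtained as the difference of two consecutive limits. -/
theorem lyapunovExists (hf : MeasurePreserving f μ μ) (hB : B ∈ logIntegrable μ c d) {k : ℕ}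
    (hk : k < c + d) : LyapunovExists μ f B k := by
  refine ⟨fun n => integrable_log_singVal_cocycleIter hf hB n hk, tendsto_nhds_limUnder ?_⟩
  obtain ⟨L, hL⟩ := exists_tendsto_sum_lyapunovSeq hf hB (k := k + 1) hk
  obtain ⟨L', hL'⟩ := exists_tendsto_sum_lyapunovSeq hf hB hk.le
  refine ⟨L - L', (hL.sub hL').congr fun n => ?_⟩
  rw [Finset.sum_range_succ, add_sub_cancel_left]

end Lyapunov

/-! ### Averaging over the phase -/

section Average

theorem abs_hermanN_cocycleIter_phaseRotation_le {X : Type*} {f : X → X} {c d : ℕ}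
    {A : X → Matrix (Fin c ⊕ Fin d) (Fin c ⊕ Fin d) ℂ} (hA : ∀ x, A x ∈ pseudoUnitary c d) (n : ℕ)
    (θ : ℝ) (x : X) :
    |hermanN d (cocycleIter f (fun x => phaseRotation c d θ * A x) n x)| ≤
      d * ∑ j ∈ Finset.range n, Real.log (euclideanOpNorm (A (f^[j] x))) := by
  have hmem : ∀ x, phaseRotation c d θ * A x ∈ pseudoUnitary c d := fun x =>
    pseudoUnitary_mul (phaseRotation_mem_pseudoUnitary θ) (hA x)
  refine (abs_hermanN_le (cocycleIter_mem_pseudoUnitary f hmem n x)).trans ?_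
  gcongr
  refine (log_euclideanOpNorm_cocycleIter_le hmem n x).trans ?_
  exact Finset.sum_le_sum fun j _ => log_euclideanOpNorm_phaseRotation_mul_le (hA _) θ

variable {X : Type*} [MeasurableSpace X] {μ : Measure X} {f : X → X} {c d : ℕ}
  {A : X → Matrix (Fin c ⊕ Fin d) (Fin c ⊕ Fin d) ℂ}

theorem measurable_phaseRotation_mul (hA : ∀ i j, Measurable fun x => A x i j)
    (i j : Fin c ⊕ Fin d) :
    Measurable fun p : ℝ × X => (phaseRotation c d p.1 * A p.2) i j := by
  have hR : ∀ i j, Measurable fun p : ℝ × X => phaseRotation c d p.1 i j := by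
    have hexp : Measurable fun p : ℝ × X =>
        Complex.exp (2 * (Real.pi : ℂ) * Complex.I * (p.1 : ℂ)) :=
      Complex.measurable_exp.comp
        ((Complex.measurable_ofReal.comp measurable_fst).const_mul _)
    rintro (i | i) (j | j)
    · exact hexp.mul_const ((1 : Matrix (Fin c) (Fin c) ℂ) i j)
    · exact measurable_const (a := (0 : ℂ))
    · exact measurable_const (a := (0 : ℂ))
    · exact measurable_const (a := (1 : Matrix (Fin d) (Fin d) ℂ) i j)
  have hA' : ∀ i j, Measurable fun p : ℝ × X => A p.2 i j := fun i j =>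
    (hA i j).comp measurable_snd
  simp only [Matrix.mul_apply]
  exact Finset.measurable_sum _ fun k _ => (hR i k).mul (hA' k j)

theorem phaseRotation_mul_mem_logIntegrable (hA : A ∈ logIntegrable μ c d) (θ : ℝ) :
    (fun x => phaseRotation c d θ * A x) ∈ logIntegrable μ c d := by
  have hmeas : ∀ i j, Measurable fun x => (phaseRotation c d θ * A x) i j := by
    intro i j
    have h := measurable_phaseRotation_mul (c := c) (d := d) hA.1 i j
    have h' := h.comp (measurable_prodMk_left (x := θ))
    exact h'
  have hmem : ∀ x, phaseRotation c d θ * A x ∈ pseudoUnitary c d := fun x =>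
    pseudoUnitary_mul (phaseRotation_mem_pseudoUnitary θ) (hA.2.1 x)
  refine ⟨hmeas, hmem, (integrable_log_euclideanOpNorm hA).mono' ?_ ?_⟩
  · have h : Measurable fun x => euclideanOpNorm (phaseRotation c d θ * A x) :=
      measurable_comp_matrix continuous_euclideanOpNorm hmeas
    exact h.log.aestronglyMeasurable
  · refine Eventually.of_forall fun x => ?_
    change |Real.log (euclideanOpNorm _)| ≤ _
    rw [abs_of_nonneg (log_euclideanOpNorm_nonneg (hmem x))]
    exact log_euclideanOpNorm_phaseRotation_mul_le (hA.2.1 x) θ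

theorem integrable_hermanN (hA : A ∈ logIntegrable μ c d) :
    Integrable (fun x => hermanN d (A x)) μ :=
  ((integrable_log_euclideanOpNorm hA).const_mul (d : ℝ)).mono'
    (measurable_hermanN d hA.1).aestronglyMeasurable
    (Eventually.of_forall fun x => abs_hermanN_le (hA.2.1 x))

theorem measurable_hermanN_cocycleIter_phaseRotation (hf : Measurable f)
    (hA : ∀ i j, Measurable fun x => A x i j) (n : ℕ) :
    Measurable fun p : ℝ × X =>
      hermanN d (cocycleIter f (fun x => phaseRotation c d p.1 * A x) n p.2) :=
  measurable_hermanN d fun i j => measurable_cocycleIter hf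
    (B := fun (θ : ℝ) x => phaseRotation c d θ * A x) (measurable_phaseRotation_mul hA) n i j

theorem integral_integral_hermanN_cocycleIter [SFinite μ] (hf : MeasurePreserving f μ μ)
    (hA : A ∈ logIntegrable μ c d) (n : ℕ) :
    ∫ θ in (0 : ℝ)..1,
      ∫ x, hermanN d (cocycleIter f (fun x => phaseRotation c d θ * A x) n x) ∂μ =
        n * ∫ x, hermanN d (A x) ∂μ := by
  rw [intervalIntegral_integral_swap]
  · simp_rw [integral_hermanN_cocycleIter f hA.2.1]
    exact integral_sum_comp_iterate hf (integrable_hermanN hA) n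
  · rw [Set.uIoc_of_le zero_le_one]
    have h := (integrable_sum_comp_iterate hf (integrable_log_euclideanOpNorm hA) n).const_mul
      (d : ℝ)
    refine (h.comp_snd (volume.restrict (Set.Ioc (0 : ℝ) 1))).mono'
      (measurable_hermanN_cocycleIter_phaseRotation hf.measurable hA.1 n).aestronglyMeasurable ?_
    exact Eventually.of_forall fun p =>
      abs_hermanN_cocycleIter_phaseRotation_le hA.2.1 n p.1 p.2

theorem measurable_lyapunovSeq_phaseRotation [SFinite μ] (hf : Measurable f)
    (hA : ∀ i j, Measurable fun x => A x i j) (k n : ℕ) :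
    Measurable fun θ : ℝ => lyapunovSeq μ f (fun x => phaseRotation c d θ * A x) k n := by
  have h : Measurable fun p : ℝ × X =>
      Real.log (singVal (cocycleIter f (fun x => phaseRotation c d p.1 * A x) n p.2) k) :=
    Real.measurable_log.comp (measurable_comp_matrix (continuous_singVal k) fun i j =>
      measurable_cocycleIter hf (B := fun (θ : ℝ) x => phaseRotation c d θ * A x)
        (measurable_phaseRotation_mul hA) n i j)
  exact (h.stronglyMeasurable.integral_prod_right' (ν := μ)).measurable.const_mul _

theorem abs_sum_lyapunovSeq_sub_integral_hermanN_le [IsProbabilityMeasure μ]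
    (hf : MeasurePreserving f μ μ) {B : X → Matrix (Fin c ⊕ Fin d) (Fin c ⊕ Fin d) ℂ}
    (hB : B ∈ logIntegrable μ c d) (n : ℕ) :
    |∑ k ∈ Finset.range d, lyapunovSeq μ f B k n -
      (1 / (n : ℝ)) * ∫ x, hermanN d (cocycleIter f B n x) ∂μ| ≤
        (1 / (n : ℝ)) * (d * Real.log 2) := by
  have hint : ∀ k ∈ Finset.range d,
      Integrable (fun x => Real.log (singVal (cocycleIter f B n x) k)) μ := fun k hk =>
    integrable_log_singVal_cocycleIter hf hB n (by have := Finset.mem_range.mp hk; omega)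
  have hmem := cocycleIter_mem_pseudoUnitary f hB.2.1 n
  have hN : Integrable (fun x => hermanN d (cocycleIter f B n x)) μ := by
    refine ((integrable_sum_comp_iterate hf (integrable_log_euclideanOpNorm hB) n).const_mul
      (d : ℝ)).mono' (measurable_hermanN d
        (measurable_cocycleIter_apply hf.measurable hB.1 n)).aestronglyMeasurable ?_
    exact Eventually.of_forall fun x => (abs_hermanN_le (hmem x)).trans
      (mul_le_mul_of_nonneg_left (log_euclideanOpNorm_cocycleIter_le hB.2.1 n x)
        (Nat.cast_nonneg d))
  simp only [lyapunovSeq]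
  rw [← Finset.mul_sum, ← integral_finsetSum _ hint, ← mul_sub,
    ← integral_sub (integrable_finsetSum _ hint) hN, abs_mul, abs_of_nonneg (by positivity)]
  gcongr
  rw [← Real.norm_eq_abs]
  refine (norm_integral_le_of_norm_le_const (C := d * Real.log 2)
    (Eventually.of_forall fun x => abs_sum_log_singVal_sub_hermanN_le (hmem x))).trans ?_
  simp

end Average

/-! ### Passage to the limit -/

theorem theorem1 {X : Type*} [MeasurableSpace X] (μ : Measure X) [IsProbabilityMeasure μ]
    (f : X → X) (hf : MeasurePreserving f μ μ) (c d : ℕ)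
    (A : X → Matrix (Fin c ⊕ Fin d) (Fin c ⊕ Fin d) ℂ) (hA : A ∈ logIntegrable μ c d) :
    (∀ θ ∈ Set.Icc (0 : ℝ) 1, ∀ k < c + d,
      LyapunovExists μ f (fun x => phaseRotation c d θ * A x) k) ∧
    IntervalIntegrable (fun θ : ℝ => lyapunovSum μ f (fun x => phaseRotation c d θ * A x) d)
      volume 0 1 ∧
    Integrable (fun x => hermanN d (A x)) μ ∧
    ∫ θ in (0 : ℝ)..1, lyapunovSum μ f (fun x => phaseRotation c d θ * A x) d =
      ∫ x, hermanN d (A x) ∂μ := by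
  have hB := phaseRotation_mul_mem_logIntegrable hA
  set S : ℕ → ℝ → ℝ := fun n θ =>
    ∑ k ∈ Finset.range d, lyapunovSeq μ f (fun x => phaseRotation c d θ * A x) k n with hS
  -- This dominates `S n θ` uniformly in `n` and `θ`, because `U_θ` does not increase the norm.
  set C : ℝ := d * ∫ x, Real.log (euclideanOpNorm (A x)) ∂μ with hC
  have hSmeas : ∀ n, Measurable (S n) := fun n =>
    Finset.measurable_sum _ fun k _ => measurable_lyapunovSeq_phaseRotation hf.measurable hA.1 k n
  have hSlim : ∀ θ, Tendsto (fun n => S n θ) atTop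
      (𝓝 (lyapunovSum μ f (fun x => phaseRotation c d θ * A x) d)) := fun θ =>
    tendsto_finsetSum _ fun k hk =>
      (lyapunovExists hf (hB θ) (by have := Finset.mem_range.mp hk; omega)).2
  have hSbound : ∀ n θ, ‖S n θ‖ ≤ C := by
    intro n θ
    refine (Finset.abs_sum_le_sum_abs _ _).trans ?_
    refine (Finset.sum_le_card_nsmul _ _ (∫ x, Real.log (euclideanOpNorm (A x)) ∂μ)
      fun k hk => ?_).trans (by simp [hC])
    refine (abs_lyapunovSeq_le hf (hB θ) n (by have := Finset.mem_range.mp hk; omega)).trans ?_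
    exact integral_mono (integrable_log_euclideanOpNorm (hB θ)) (integrable_log_euclideanOpNorm hA)
      fun x => log_euclideanOpNorm_phaseRotation_mul_le (hA.2.1 x) θ
  have hLmeas : StronglyMeasurable
      fun θ : ℝ => lyapunovSum μ f (fun x => phaseRotation c d θ * A x) d :=
    stronglyMeasurable_of_tendsto atTop (fun n => (hSmeas n).stronglyMeasurable)
      (tendsto_pi_nhds.mpr hSlim)
  have hint : ∀ {g : ℝ → ℝ}, Measurable g → (∀ θ, ‖g θ‖ ≤ C) → IntervalIntegrable g volume 0 1 :=
    fun hg hgC => (intervalIntegrable_const (c := C)).mono_fun' hg.aestronglyMeasurable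
      (Eventually.of_forall hgC)
  refine ⟨fun θ _ k hk => lyapunovExists hf (hB θ) hk, hint hLmeas.measurable fun θ =>
    le_of_tendsto (hSlim θ).norm (Eventually.of_forall fun n => hSbound n θ),
    integrable_hermanN hA, ?_⟩
  have hlim1 : Tendsto (fun n => ∫ θ in (0 : ℝ)..1, S n θ) atTop
      (𝓝 (∫ θ in (0 : ℝ)..1, lyapunovSum μ f (fun x => phaseRotation c d θ * A x) d)) :=
    intervalIntegral.tendsto_integral_filter_of_dominated_convergence (fun _ => C)
      (Eventually.of_forall fun n => (hSmeas n).aestronglyMeasurable)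
      (Eventually.of_forall fun n => Eventually.of_forall fun θ _ => hSbound n θ)
      intervalIntegrable_const (Eventually.of_forall fun θ _ => hSlim θ)
  refine tendsto_nhds_unique hlim1 ?_
  rw [tendsto_iff_norm_sub_tendsto_zero]
  have hlim2 : Tendsto (fun n : ℕ => (1 / (n : ℝ)) * (d * Real.log 2)) atTop (𝓝 0) := by
    simpa using tendsto_one_div_atTop_nhds_zero_nat.mul_const (d * Real.log 2)
  refine squeeze_zero' (Eventually.of_forall fun _ => norm_nonneg _) ?_ hlim2
  filter_upwards [eventually_gt_atTop 0] with n hn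
  have hn' : (n : ℝ) ≠ 0 := Nat.cast_ne_zero.mpr hn.ne'
  have hJ := integral_integral_hermanN_cocycleIter hf hA n
  have hJint : IntervalIntegrable (fun θ : ℝ =>
      ∫ x, hermanN d (cocycleIter f (fun x => phaseRotation c d θ * A x) n x) ∂μ) volume 0 1 := by
    refine (intervalIntegrable_const (c := d * (n * ∫ x, Real.log (euclideanOpNorm (A x)) ∂μ))).mono_fun'
      ((measurable_hermanN_cocycleIter_phaseRotation hf.measurable
        hA.1 n).stronglyMeasurable.integral_prod_right' (ν := μ)).aestronglyMeasurable
      (Eventually.of_forall fun θ => ?_)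
    dsimp only
    rw [← integral_sum_comp_iterate hf (integrable_log_euclideanOpNorm hA), ← integral_const_mul]
    exact norm_integral_le_of_norm_le
      ((integrable_sum_comp_iterate hf (integrable_log_euclideanOpNorm hA) n).const_mul _)
      (Eventually.of_forall fun x => abs_hermanN_cocycleIter_phaseRotation_le hA.2.1 n θ x)
  -- The target, independent of `n`, is rewritten as a `θ`-integral at time `n`, so that it can be
  -- compared with `S n` at each `θ` with error `d ln 2 / n`. Dividing by `n` needs `n ≠ 0`.
  have hJ' : ∫ x, hermanN d (A x) ∂μ = ∫ θ in (0 : ℝ)..1, (1 / (n : ℝ)) *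
      ∫ x, hermanN d (cocycleIter f (fun x => phaseRotation c d θ * A x) n x) ∂μ := by
    rw [intervalIntegral.integral_const_mul, hJ, one_div, inv_mul_cancel_left₀ hn']
  rw [hJ', ← intervalIntegral.integral_sub (hint (hSmeas n) (hSbound n)) (hJint.const_mul _)]
  refine (intervalIntegral.norm_integral_le_of_norm_le_const fun θ _ =>
    abs_sum_lyapunovSeq_sub_integral_hermanN_le hf (hB θ) n).trans ?_
  simp
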